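/- **Definitions.** An *extended affine Lie algebra* is a triple $(E,(\cdot,\cdot),\mathcal H)$, where $E$ is a complex Lie algebra, $\mathcal H\ne 0$ is a finite-dimensional subalgebra, and $(\cdot,\cdot)$ is a symmetric $\mathbb C$-bilinear form on $E$, such that: (A1) the form is invariant and non-degenerate; (A2) $E=\sum_{\alpha\in R}E_\alpha$ and $E_0=\mathcal H$, where $E_\alpha=\{x\in E: [h,x]=\alpha(h)x\ \forall h\in\mathcal H\}$ for $\alpha\in\mathcal H^\star$ and $R=\{\alpha\in\mathcal H^\star: E_\alpha\neq 0\}$; (A3) $\operatorname{ad}(x)$ is locally nilpotent on $E$ for every $x\in E_\alpha$, $\alpha\in R^\times$; (A4) the centralizer in $E$ of the core $E_c$ (the subalgebra generated by all $E_\alpha$, $\alpha\in R^\times$) is contained in $E_c$; (A5) the $\mathbb Z$-span of $R$ is a free abelian group of finite rank; (A6) $R^\times$ is not a disjoint union of two non-empty mutually orthogonal subsets. Here the form on $\mathcal H^\star$ is $(\alpha,\beta)=(t_\alpha,t_\beta)$, with $t_\alpha\in\mathcal H$ determined by $\alpha(h)=(h,t_\alpha)$ for all $h\in\mathcal H$;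 further $R^0=\{\alpha\in R:(\alpha,\alpha)=0\}$ and $R^\times=R\setminus R^0$. The *type* of $E$ is the type of the finite root system $\bar R$, the image of $R$ in $\operatorname{span}_{\mathbb R}R/\operatorname{span}_{\mathbb R}R^0$; it is assumed that $\bar R$ is reduced. A *Cartan automorphism* of $E$ is a Lie algebra automorphism $\Psi$ with $\Psi(h)=h$ for all $h\in\mathcal H$; it is *diagonal* if it acts on every root space $E_\alpha$, $\alpha\in R$, as a scalar. For $\alpha\in R^\times$ the scalar $\eta_\alpha\in\mathbb C^\times$ is defined by $\Psi(x)=\eta_\alpha x$ for $x\in E_\alpha$. The *map associated with* $\Psi$ is $\psi:R\to\mathbb C^\times$ with $\psi(\alpha)=\eta_\alpha$ for $\alpha\in R^\times$ and $\psi(\sigma)=\eta_{\alpha+\sigma}\,\eta_{-\alpha}$ for $\sigma\in R^0$ and any $\alpha\in R^\times$ with $\alpha+\sigma\in R^\times$. A map $\psi:R\to\mathbb C^\times$ is a *character* if $\psi(\alpha+\beta)=\psi(\alpha)\psi(\beta)$ whenever $\alpha,\beta,\alpha+\beta\in R$. **Proposition.** Let $E$ be an extended affine Lie algebra of type $C_\ell$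 $(\ell\ge 3)$, $F_4$ or $G_2$, and let $\Psi$ be a Cartan automorphism of $E$ of finite order. Then $\Psi$ is diagonal, the map $\psi:R\to\mathbb C^\times$ associated with $\Psi$ is well defined (it exists and is unique), and $\psi$ is a character. -/

import Mathlib

open Module

noncomputable section

/-- A complex Lie algebra `E` with a non-zero finite-dimensional splitting Cartan subalgebra `H`
and a non-degenerate invariant symmetric bilinear form. -/
structure SplitInvariantLie (E : Type*) [LieRing E] [LieAlgebra ℂ E] where
  /-- The Cartan subalgebra. -/
  H : LieSubalgebra ℂ E
  /-- The bilinear form `(·,·)` on `E`. -/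
  form : LinearMap.BilinForm ℂ E
  H_ne_bot : H ≠ ⊥
  H_finite : FiniteDimensional ℂ H
  form_symm : form.IsSymm
  form_invariant : form.lieInvariant E
  form_nondegenerate : form.Nondegenerate
  /-- `E` is the sum of the spaces `E_α` over all `α` in the dual of `H`
  (equivalently, over those `α` for which `E_α ≠ 0`). -/
  iSup_weightSpace : ⨆ α : Dual ℂ H, (LieModule.weightSpace E (α : H → ℂ)).toSubmodule = ⊤
  /-- `E_0 = H`. -/
  weightSpace_zero : (LieModule.weightSpace E (0 : H → ℂ)).toSubmodule = H.toSubmodule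

namespace SplitInvariantLie

variable {E : Type*} [LieRing E] [LieAlgebra ℂ E] (T : SplitInvariantLie E)

instance : FiniteDimensional ℂ T.H := T.H_finite

/-- `E_α = {x | [h, x] = α(h) x for all h ∈ H}`. -/
def rootSpace (α : Dual ℂ T.H) : Submodule ℂ E :=
  (LieModule.weightSpace E (α : T.H → ℂ)).toSubmodule

lemma mem_rootSpace (α : Dual ℂ T.H) (x : E) :
    x ∈ T.rootSpace α ↔ ∀ h : T.H, ⁅(h : E), x⁆ = α h • x := by
  simp [rootSpace, LieModule.mem_weightSpace]

/-- The root system `R = {α | E_α ≠ 0}`; it contains `0`. -/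
def roots : Set (Dual ℂ T.H) := {α | T.rootSpace α ≠ ⊥}

/-- The form restricted to `H`. -/
def formH : LinearMap.BilinForm ℂ T.H := T.form.restrict T.H.toSubmodule

lemma formH_apply (a b : T.H) : T.formH a b = T.form a b := rfl

lemma lie_eq_zero (a b : T.H) : ⁅(a : E), (b : E)⁆ = 0 := by
  have hb : (b : E) ∈ (LieModule.weightSpace E (0 : T.H → ℂ)).toSubmodule := by
    rw [T.weightSpace_zero]; exact b.2
  have := (LieModule.mem_weightSpace _ _).1 hb a
  simpa using this

lemma form_rootSpace_eq_zero {α : Dual ℂ T.H} (hα : α ≠ 0) (h : T.H) {x : E}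
    (hx : x ∈ T.rootSpace α) : T.form h x = 0 := by
  obtain ⟨a, ha⟩ : ∃ a, α a ≠ 0 := by
    by_contra! hc
    exact hα (LinearMap.ext hc)
  have h1 := T.form_invariant a h x
  rw [T.lie_eq_zero, (T.mem_rootSpace α x).1 hx a] at h1
  simpa [ha] using h1

/-- The form is non-degenerate on `H`. -/
lemma formH_nondegenerate : T.formH.Nondegenerate := by
  have key : ∀ a : T.H, (∀ b : T.H, T.form a b = 0) → a = 0 := by
    intro a ha
    have h0 : ∀ x : E, T.form a x = 0 := by
      intro x
      have hx : x ∈ ⨆ α : Dual ℂ T.H, (LieModule.weightSpace E (α : T.H → ℂ)).toSubmodule := by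
        rw [T.iSup_weightSpace]; trivial
      have hle : (⨆ α : Dual ℂ T.H, (LieModule.weightSpace E (α : T.H → ℂ)).toSubmodule)
          ≤ LinearMap.ker (T.form a) := by
        refine iSup_le fun α y hy => ?_
        rw [LinearMap.mem_ker]
        by_cases hα : α = 0
        · subst hα
          have hy' : y ∈ T.H.toSubmodule := by
            rw [← T.weightSpace_zero]; exact hy
          exact ha ⟨y, hy'⟩
        · exact T.form_rootSpace_eq_zero hα a hy
      exact hle hx
    exact Subtype.ext (T.form_nondegenerate.1 a h0)
  refine ⟨fun a ha => key a ha, fun a ha => key a fun b => ?_⟩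
  rw [T.form_symm.eq]
  exact ha b

/-- The unique `t_α ∈ H` with `α(h) = (h, t_α)` for all `h ∈ H`. -/
def t (α : Dual ℂ T.H) : T.H := (T.formH.toDual T.formH_nondegenerate).symm α

lemma form_t (α : Dual ℂ T.H) (h : T.H) : T.form h (T.t α) = α h := by
  rw [T.form_symm.eq]
  have h1 : T.formH.toDual T.formH_nondegenerate (T.t α) h = T.form (T.t α) h :=
    LinearMap.BilinForm.toDual_def _
  rw [← h1, t, LinearEquiv.apply_symm_apply]

/-- The form on the dual of `H`: `(α, β) = (t_α, t_β)`. -/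
def dualForm (α β : Dual ℂ T.H) : ℂ := T.form (T.t α) (T.t β)

/-- The isotropic roots `R⁰`. -/
def isotropicRoots : Set (Dual ℂ T.H) := {α | α ∈ T.roots ∧ T.dualForm α α = 0}

/-- The non-isotropic roots `R^×`. -/
def nonisotropicRoots : Set (Dual ℂ T.H) := {α | α ∈ T.roots ∧ T.dualForm α α ≠ 0}

/-- The core: the subalgebra generated by the non-isotropic root spaces. -/
def core : LieSubalgebra ℂ E :=
  LieSubalgebra.lieSpan ℂ E (⋃ α ∈ T.nonisotropicRoots, (T.rootSpace α : Set E))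

end SplitInvariantLie

/-- An extended affine Lie algebra `(E, (·,·), H)` (tameness included). -/
structure ExtendedAffineLie (E : Type*) [LieRing E] [LieAlgebra ℂ E]
    extends SplitInvariantLie E where
  /-- `ad x` is locally nilpotent for `x` in a non-isotropic root space. -/
  ad_locally_nilpotent : ∀ α ∈ toSplitInvariantLie.nonisotropicRoots,
    ∀ x ∈ toSplitInvariantLie.rootSpace α, ∀ y : E, ∃ n : ℕ, (LieAlgebra.ad ℂ E x ^ n) y = 0
  /-- Tameness: the centralizer of the core lies in the core. -/
  tame : ∀ x : E, (∀ y ∈ toSplitInvariantLie.core, ⁅x, y⁆ = 0) → x ∈ toSplitInvariantLie.core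
  /-- The `ℤ`-span of the roots is free abelian of finite rank. -/
  root_lattice_free : Module.Free ℤ (Submodule.span ℤ toSplitInvariantLie.roots)
  root_lattice_finite : Module.Finite ℤ (Submodule.span ℤ toSplitInvariantLie.roots)
  /-- `R^×` is indecomposable. -/
  indecomposable : ∀ R₁ R₂ : Set (Dual ℂ toSplitInvariantLie.H),
    R₁ ∪ R₂ = toSplitInvariantLie.nonisotropicRoots → Disjoint R₁ R₂ →
    R₁.Nonempty → R₂.Nonempty →
    ∃ α ∈ R₁, ∃ β ∈ R₂, toSplitInvariantLie.dualForm α β ≠ 0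

namespace ExtendedAffineLie

variable {E : Type*} [LieRing E] [LieAlgebra ℂ E] (T : ExtendedAffineLie E)

/-- `V`, the real span of the roots. -/
abbrev V : Submodule ℝ (Dual ℂ T.H) := Submodule.span ℝ T.roots

/-- `V⁰`, the real span of the isotropic roots, as a subspace of `V`. -/
abbrev V0 : Submodule ℝ T.V := (Submodule.span ℝ T.isotropicRoots).submoduleOf T.V

/-- `V̄ = V / V⁰`. -/
abbrev Vbar : Type _ := T.V ⧸ T.V0

/-- `R̄ \ {0}`, where `R̄` is the image of `R` in `V̄`. -/
def barRoots : Set T.Vbar :=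
  {v | v ≠ 0 ∧ ∃ α : T.V, (α : Dual ℂ T.H) ∈ T.roots ∧ T.V0.mkQ α = v}

/-- The type of `E` is given by the Cartan matrix `A`: the non-zero elements of `R̄` form a finite
reduced crystallographic root system in `V̄` having a base with Cartan matrix `A`, up to a
relabelling of the simple roots. -/
def HasCartanType {n : ℕ} (A : Matrix (Fin n) (Fin n) ℤ) : Prop :=
  ∃ (P : RootPairing T.barRoots ℝ T.Vbar (Dual ℝ T.Vbar)) (_ : P.IsCrystallographic),
    T.barRoots.Finite ∧ P.IsRootSystem ∧ P.IsReduced ∧ (∀ i, P.root i = i) ∧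
    ∃ (b : P.Base) (e : b.support ≃ Fin n), ∀ i j, b.cartanMatrix i j = A (e i) (e j)

/-- A Cartan automorphism fixes `H` pointwise. -/
def IsCartanAutomorphism (Ψ : E ≃ₗ⁅ℂ⁆ E) : Prop := ∀ h : T.H, Ψ (h : E) = h

/-- `Ψ` acts on each root space as a scalar multiple of the identity. -/
def IsDiagonal (Ψ : E ≃ₗ⁅ℂ⁆ E) : Prop :=
  ∀ α ∈ T.roots, ∃ c : ℂ, ∀ x ∈ T.rootSpace α, Ψ x = c • x

/-- `ψ : R → ℂ^×` is the map associated with `Ψ`: `ψ(α) = η_α` with `Ψ x = η_α x` on `E_α` for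
`α ∈ R^×`, and `ψ(σ) = η_{α+σ} η_{-α}` for `σ ∈ R⁰` and every `α ∈ R^×` with `α + σ ∈ R^×`. -/
def IsAssociatedMap (Ψ : E ≃ₗ⁅ℂ⁆ E) (ψ : T.roots → ℂˣ) : Prop :=
  (∀ α : T.roots, (α : Dual ℂ T.H) ∈ T.nonisotropicRoots →
    ∀ x ∈ T.rootSpace α, Ψ x = (ψ α : ℂ) • x) ∧
  (∀ σ α β γ : T.roots, (σ : Dual ℂ T.H) ∈ T.isotropicRoots →
    (α : Dual ℂ T.H) ∈ T.nonisotropicRoots → (β : Dual ℂ T.H) ∈ T.nonisotropicRoots →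
    (β : Dual ℂ T.H) = α + σ → (γ : Dual ℂ T.H) = -α → ψ σ = ψ β * ψ γ)

/-- A character of `R`: multiplicative whenever `α, β, α + β` are all roots. -/
def IsCharacter (ψ : T.roots → ℂˣ) : Prop :=
  ∀ α β γ : T.roots, (γ : Dual ℂ T.H) = α + β → ψ γ = ψ α * ψ β

end ExtendedAffineLie

end

noncomputable section

/-! ### The invariant form, root spaces and the `sl₂`-triples of non-isotropic roots. -/

namespace SplitInvariantLie

variable {E : Type*} [LieRing E] [LieAlgebra ℂ E] (T : SplitInvariantLie E)

/-! Non-isotropic root spaces are lines (`exists_eq_smul`), so `Ψ` acts on each by a scalar `η`, and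
since brackets between them are non-zero whenever the sum is a root (`lie_ne_zero`), `η` is
multiplicative on `R^×`. Everything then turns on whether `η (α + σ) / η α` is independent of `α`
for isotropic `σ`.

In types `C_ℓ`, `F₄`, `G₂` any two short roots of the finite root system are joined by a chain of
short roots, consecutive ones at angle `π / 3`, and every long root is a sum of two short ones
(`exists_isLinkedClass`, lifted to `R` by `exists_isShortClass`). If `α` and `β` are consecutive in
such a chain, then `β - α` is a non-isotropic root, so `η (β + σ)` and `η β` share the factor `η (β
- α)` and the ratio is the same at `α` and `β`. Long roots inherit it from their short summands
(`IsShortClass.ratio_eq`). Isotropic roots are orthogonal to all roots and, by tameness, never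
isolated, so the ratios exist. Hence `η` extends to a multiplicative function `χ` on `R`
(`IsShortClass.extendScalar_add`).

For diagonality, `χ` defines a diagonal endomorphism `D` agreeing with `Ψ` on the core. On `E_σ` the
defect `z = Ψ x - χ(σ) x` centralizes the core, so lies in it by tameness, so `Ψ z = χ(σ) z`. A
non-zero `z` would give a Jordan block of size two, which has infinite order (`apply_eq_smul`). -/

lemma lie_mem_rootSpace {α β : Dual ℂ T.H} {x y : E} (hx : x ∈ T.rootSpace α)
    (hy : y ∈ T.rootSpace β) : ⁅x, y⁆ ∈ T.rootSpace (α + β) := by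
  rw [mem_rootSpace] at *
  intro h
  rw [leibniz_lie, hx, hy, smul_lie, lie_smul, ← add_smul, LinearMap.add_apply]

lemma rootSpace_zero : T.rootSpace 0 = T.H.toSubmodule := T.weightSpace_zero

lemma iSup_rootSpace : ⨆ α, T.rootSpace α = ⊤ := T.iSup_weightSpace

lemma form_comm (x y : E) : T.form x y = T.form y x := T.form_symm.eq x y

lemma form_lie_left (x y z : E) : T.form ⁅x, y⁆ z = -T.form y ⁅x, z⁆ := T.form_invariant x y z

lemma form_lie_right (x y z : E) : T.form x ⁅y, z⁆ = T.form ⁅x, y⁆ z := by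
  rw [← lie_skew x y, map_neg, LinearMap.neg_apply, form_lie_left, neg_neg]

lemma form_eq_zero_of_add_ne_zero {α β : Dual ℂ T.H} (hαβ : α + β ≠ 0) {x y : E}
    (hx : x ∈ T.rootSpace α) (hy : y ∈ T.rootSpace β) : T.form x y = 0 := by
  obtain ⟨a, ha⟩ : ∃ a, (α + β) a ≠ 0 := by
    by_contra! hc
    exact hαβ (LinearMap.ext hc)
  have h1 := T.form_lie_left a x y
  rw [(T.mem_rootSpace α x).1 hx, (T.mem_rootSpace β y).1 hy] at h1
  simp only [map_smul, LinearMap.smul_apply, smul_eq_mul] at h1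
  have : (α + β) a * T.form x y = 0 := by
    rw [LinearMap.add_apply]; linear_combination h1
  exact (mul_eq_zero.1 this).resolve_left ha

/-- Both sides lie in `H` and, by invariance, have the same pairing with every element of `H`. -/
lemma lie_eq_form_smul_t {α : Dual ℂ T.H} {x y : E} (hx : x ∈ T.rootSpace α)
    (hy : y ∈ T.rootSpace (-α)) : ⁅x, y⁆ = T.form x y • (T.t α : E) := by
  have h0 : ⁅x, y⁆ ∈ T.H.toSubmodule := by
    rw [← rootSpace_zero, ← add_neg_cancel α]
    exact T.lie_mem_rootSpace hx hy
  have key : (⟨⁅x, y⁆, h0⟩ : T.H) = T.form x y • T.t α := by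
    rw [← sub_eq_zero]
    refine T.formH_nondegenerate.1 _ fun h => ?_
    rw [map_sub, map_smul, LinearMap.sub_apply, LinearMap.smul_apply, formH_apply, formH_apply,
      T.form_comm (T.t α), T.form_t, form_lie_left, ← lie_skew, (T.mem_rootSpace α x).1 hx, map_neg,
      map_smul, T.form_comm y]
    simp [mul_comm]
  exact congrArg Subtype.val key

/-- The form pairs `E_α` only with `E_{-α}`, so non-degeneracy on `E` is non-degeneracy of that
pairing. -/
lemma exists_form_eq_one {α : Dual ℂ T.H} {x : E} (hx : x ∈ T.rootSpace α) (hx0 : x ≠ 0) :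
    ∃ y ∈ T.rootSpace (-α), T.form x y = 1 := by
  obtain ⟨y, hy, hxy⟩ : ∃ y ∈ T.rootSpace (-α), T.form x y ≠ 0 := by
    by_contra! hc
    refine hx0 (T.form_nondegenerate.1 x fun y => ?_)
    have hle : (⨆ β, T.rootSpace β) ≤ LinearMap.ker (T.form x) := by
      refine iSup_le fun β z hz => ?_
      rw [LinearMap.mem_ker]
      by_cases h : α + β = 0
      · exact hc z (by rwa [neg_eq_of_add_eq_zero_right h])
      · exact T.form_eq_zero_of_add_ne_zero h hx hz
    rw [iSup_rootSpace] at hle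
    exact hle trivial
  refine ⟨(T.form x y)⁻¹ • y, Submodule.smul_mem _ _ hy, ?_⟩
  rw [map_smul, smul_eq_mul, inv_mul_cancel₀ hxy]

lemma mem_roots_of_ne_zero {α : Dual ℂ T.H} {x : E} (hx : x ∈ T.rootSpace α) (hx0 : x ≠ 0) :
    α ∈ T.roots := fun h => hx0 (by simpa [h] using hx)

lemma exists_ne_zero_of_mem_roots {α : Dual ℂ T.H} (hα : α ∈ T.roots) :
    ∃ x ∈ T.rootSpace α, x ≠ 0 := Submodule.exists_mem_ne_zero_of_ne_bot hα

lemma eq_zero_of_notMem_roots {α : Dual ℂ T.H} (hα : α ∉ T.roots) {x : E}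
    (hx : x ∈ T.rootSpace α) : x = 0 := by
  by_contra h
  exact hα (T.mem_roots_of_ne_zero hx h)

lemma neg_mem_roots {α : Dual ℂ T.H} (hα : α ∈ T.roots) : -α ∈ T.roots := by
  obtain ⟨x, hx, hx0⟩ := T.exists_ne_zero_of_mem_roots hα
  obtain ⟨y, hy, hxy⟩ := T.exists_form_eq_one hx hx0
  exact T.mem_roots_of_ne_zero hy (by rintro rfl; simp at hxy)

lemma zero_mem_roots : 0 ∈ T.roots := by
  intro h
  rw [rootSpace_zero] at h
  exact T.H_ne_bot (by simpa using h)

lemma dualForm_eq (α β : Dual ℂ T.H) : T.dualForm α β = β (T.t α) := T.form_t β (T.t α)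

lemma dualForm_comm (α β : Dual ℂ T.H) : T.dualForm α β = T.dualForm β α := T.form_comm _ _

lemma dualForm_eq' (α β : Dual ℂ T.H) : T.dualForm α β = α (T.t β) := by
  rw [dualForm_comm, dualForm_eq]

@[simp] lemma dualForm_add_left (α β γ : Dual ℂ T.H) :
    T.dualForm (α + β) γ = T.dualForm α γ + T.dualForm β γ := by simp [dualForm_eq']

@[simp] lemma dualForm_sub_left (α β γ : Dual ℂ T.H) :
    T.dualForm (α - β) γ = T.dualForm α γ - T.dualForm β γ := by simp [dualForm_eq']

@[simp] lemma dualForm_neg_left (α γ : Dual ℂ T.H) :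
    T.dualForm (-α) γ = -T.dualForm α γ := by simp [dualForm_eq']

@[simp] lemma dualForm_smul_left (c : ℂ) (α γ : Dual ℂ T.H) :
    T.dualForm (c • α) γ = c * T.dualForm α γ := by simp [dualForm_eq']

@[simp] lemma dualForm_add_right (α β γ : Dual ℂ T.H) :
    T.dualForm γ (α + β) = T.dualForm γ α + T.dualForm γ β := by simp [dualForm_eq]

@[simp] lemma dualForm_sub_right (α β γ : Dual ℂ T.H) :
    T.dualForm γ (α - β) = T.dualForm γ α - T.dualForm γ β := by simp [dualForm_eq]

@[simp] lemma dualForm_neg_right (α γ : Dual ℂ T.H) :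
    T.dualForm γ (-α) = -T.dualForm γ α := by simp [dualForm_eq]

@[simp] lemma dualForm_smul_right (c : ℂ) (α γ : Dual ℂ T.H) :
    T.dualForm γ (c • α) = c * T.dualForm γ α := by simp [dualForm_eq]

lemma neg_mem_nonisotropicRoots {α : Dual ℂ T.H} (hα : α ∈ T.nonisotropicRoots) :
    -α ∈ T.nonisotropicRoots := ⟨T.neg_mem_roots hα.1, by simpa using hα.2⟩

lemma neg_mem_isotropicRoots {α : Dual ℂ T.H} (hα : α ∈ T.isotropicRoots) :
    -α ∈ T.isotropicRoots := ⟨T.neg_mem_roots hα.1, by simpa using hα.2⟩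

lemma isotropic_or_nonisotropic {α : Dual ℂ T.H} (hα : α ∈ T.roots) :
    α ∈ T.isotropicRoots ∨ α ∈ T.nonisotropicRoots := by
  by_cases h : T.dualForm α α = 0
  · exact .inl ⟨hα, h⟩
  · exact .inr ⟨hα, h⟩

/-- The number `2 (β, α) / (α, α)`. -/
def cartanNumber (β α : Dual ℂ T.H) : ℂ := 2 * T.dualForm β α / T.dualForm α α

/-- The coroot `2 t_α / (α, α)`. -/
def corootH (α : Dual ℂ T.H) : T.H := (2 / T.dualForm α α) • T.t α

lemma apply_corootH (α β : Dual ℂ T.H) : β (T.corootH α) = T.cartanNumber β α := by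
  rw [corootH, map_smul, ← dualForm_eq', cartanNumber, smul_eq_mul]
  ring

lemma cartanNumber_self {α : Dual ℂ T.H} (hα : T.dualForm α α ≠ 0) : T.cartanNumber α α = 2 := by
  rw [cartanNumber, mul_div_assoc, div_self hα, mul_one]

lemma lie_corootH (α : Dual ℂ T.H) {β : Dual ℂ T.H} {x : E} (hx : x ∈ T.rootSpace β) :
    ⁅(T.corootH α : E), x⁆ = T.cartanNumber β α • x := by
  rw [(T.mem_rootSpace β x).1 hx, apply_corootH]

lemma exists_isSl2Triple {α : Dual ℂ T.H} (hα : α ∈ T.nonisotropicRoots) {e : E}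
    (he : e ∈ T.rootSpace α) (he0 : e ≠ 0) :
    ∃ f ∈ T.rootSpace (-α), IsSl2Triple (T.corootH α : E) e f := by
  obtain ⟨y, hy, hxy⟩ := T.exists_form_eq_one he he0
  have hf : (2 / T.dualForm α α) • y ∈ T.rootSpace (-α) := Submodule.smul_mem _ _ hy
  refine ⟨(2 / T.dualForm α α) • y, hf, ?_, ?_, ?_, ?_⟩
  · intro h
    have h1 := T.apply_corootH α α
    rw [T.cartanNumber_self hα.2, show T.corootH α = 0 from Subtype.ext h] at h1
    simp at h1
  · rw [lie_smul, T.lie_eq_form_smul_t he hy, hxy, one_smul]; rfl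
  · rw [T.lie_corootH α he, T.cartanNumber_self hα.2, two_smul, two_nsmul]
  · rw [T.lie_corootH α hf, cartanNumber, dualForm_neg_left, mul_neg, neg_div, neg_smul,
      ← cartanNumber, T.cartanNumber_self hα.2, two_nsmul, two_smul]

lemma toEnd_pow_mem_rootSpace {α β : Dual ℂ T.H} {e x : E} (he : e ∈ T.rootSpace α)
    (hx : x ∈ T.rootSpace β) (n : ℕ) :
    (LieModule.toEnd ℂ E E e ^ n) x ∈ T.rootSpace (β + (n : ℂ) • α) := by
  induction n with
  | zero => simpa using hx
  | succ n ih =>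
    rw [pow_succ', Module.End.mul_apply, LieModule.toEnd_apply_apply]
    convert T.lie_mem_rootSpace he ih using 2
    push_cast
    module

end SplitInvariantLie

/-! ### Primitive vectors from local nilpotency instead of finite dimension. -/

namespace IsSl2Triple

variable {L M : Type*} [LieRing L] [LieAlgebra ℂ L] [AddCommGroup M] [Module ℂ M]
  [LieRingModule L M] [LieModule ℂ L M] {h e f : L}

/-- The last non-zero `e ^ k m` is killed by `e`, and each `e` raises the weight by `2`. -/
lemma exists_hasPrimitiveVectorWith_of_pow_eq_zero (t : IsSl2Triple h e f) {m : M} {μ : ℂ}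
    (hm0 : m ≠ 0) (hm : ⁅h, m⁆ = μ • m) (hnil : ∃ n : ℕ, (LieModule.toEnd ℂ L M e ^ n) m = 0) :
    ∃ k : ℕ, t.HasPrimitiveVectorWith ((LieModule.toEnd ℂ L M e ^ k) m) (μ + 2 * k) := by
  obtain ⟨k, hk, hk'⟩ := Nat.exists_not_and_succ_of_not_zero_of_exists
    (p := fun n => (LieModule.toEnd ℂ L M e ^ n) m = 0) hm0 hnil
  exact ⟨k, hk, t.lie_h_pow_toEnd_e hm k, by rwa [lie_e_pow_toEnd_e]⟩

/-- If `f ^ n m` is the last non-zero power, then `0 = e f ^ (n + 1) m = (n + 1) (μ - n) f ^ n m`.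
-/
lemma HasPrimitiveVectorWith.exists_nat_of_pow_eq_zero {t : IsSl2Triple h e f} {m : M} {μ : ℂ}
    (P : t.HasPrimitiveVectorWith m μ) (hnil : ∃ n : ℕ, (LieModule.toEnd ℂ L M f ^ n) m = 0) :
    ∃ n : ℕ, μ = n := by
  obtain ⟨n, hn₁, hn₂⟩ := Nat.exists_not_and_succ_of_not_zero_of_exists
    (p := fun n => (LieModule.toEnd ℂ L M f ^ n) m = 0) P.ne_zero hnil
  refine ⟨n, ?_⟩
  have := P.lie_e_pow_succ_toEnd_f n
  rw [hn₂, lie_zero, eq_comm, smul_eq_zero_iff_left hn₁, mul_eq_zero, sub_eq_zero] at this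
  exact this.resolve_left <| Nat.cast_add_one_ne_zero n

end IsSl2Triple

/-! ### Root strings, reflections and one-dimensionality of non-isotropic root spaces. -/

namespace ExtendedAffineLie

variable {E : Type*} [LieRing E] [LieAlgebra ℂ E] (T : ExtendedAffineLie E)

open IsSl2Triple

lemma exists_toEnd_pow_eq_zero {α : Dual ℂ T.H} (hα : α ∈ T.nonisotropicRoots) {e : E}
    (he : e ∈ T.rootSpace α) (x : E) : ∃ n : ℕ, (LieModule.toEnd ℂ E E e ^ n) x = 0 :=
  T.ad_locally_nilpotent α hα e he x

/-- A non-zero vector of weight `β` generates, for each `α ∈ R^×`, a primitive vector of weight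
`β + kα`, and all elements of the string through it are non-zero. -/
lemma exists_primitive {α β : Dual ℂ T.H} (hα : α ∈ T.nonisotropicRoots) {e f x : E}
    (he : e ∈ T.rootSpace α) (hf : f ∈ T.rootSpace (-α))
    (t : IsSl2Triple (T.corootH α : E) e f) (hx : x ∈ T.rootSpace β) (hx0 : x ≠ 0) :
    ∃ k n : ℕ, T.cartanNumber β α = (n : ℤ) - 2 * k ∧
      t.HasPrimitiveVectorWith ((LieModule.toEnd ℂ E E e ^ k) x) (n : ℂ) := by
  obtain ⟨k, P⟩ := t.exists_hasPrimitiveVectorWith_of_pow_eq_zero hx0 (T.lie_corootH α hx)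
    (T.exists_toEnd_pow_eq_zero hα he x)
  obtain ⟨n, hn⟩ := P.exists_nat_of_pow_eq_zero
    (T.exists_toEnd_pow_eq_zero (T.neg_mem_nonisotropicRoots hα) hf _)
  refine ⟨k, n, ?_, hn ▸ P⟩
  push_cast
  rw [← hn]; ring

/-- Cartan integers. -/
lemma exists_int_cartanNumber {α β : Dual ℂ T.H} (hα : α ∈ T.nonisotropicRoots)
    (hβ : β ∈ T.roots) : ∃ n : ℤ, T.cartanNumber β α = n := by
  obtain ⟨e, he, he0⟩ := T.exists_ne_zero_of_mem_roots hα.1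
  obtain ⟨f, hf, t⟩ := T.exists_isSl2Triple hα he he0
  obtain ⟨x, hx, hx0⟩ := T.exists_ne_zero_of_mem_roots hβ
  obtain ⟨k, n, h, -⟩ := T.exists_primitive hα he hf t hx hx0
  exact ⟨n - 2 * k, by rw [h]; push_cast; ring⟩

lemma sub_smul_mem_roots_of_nonneg {α β : Dual ℂ T.H} (hα : α ∈ T.nonisotropicRoots)
    (hβ : β ∈ T.roots) {n : ℕ} (hn : T.cartanNumber β α = n) : β - (n : ℂ) • α ∈ T.roots := by
  obtain ⟨e, he, he0⟩ := T.exists_ne_zero_of_mem_roots hα.1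
  obtain ⟨f, hf, t⟩ := T.exists_isSl2Triple hα he he0
  obtain ⟨x, hx, hx0⟩ := T.exists_ne_zero_of_mem_roots hβ
  obtain ⟨k, m, h, P⟩ := T.exists_primitive hα he hf t hx hx0
  rw [hn] at h
  have hm : m = n + 2 * k := by
    have : (n : ℂ) + 2 * k = m := by push_cast at h; rw [h]; ring
    exact_mod_cast this.symm
  -- Having climbed `k` steps, descend `n + k`: a net shift by `-n α`, still inside the string of
  -- length `m = n + 2 k`.
  have h1 := P.pow_toEnd_f_ne_zero_of_eq_nat rfl (i := n + k) (by omega)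
  have h2 := T.toEnd_pow_mem_rootSpace hf (T.toEnd_pow_mem_rootSpace he hx k) (n + k)
  convert T.mem_roots_of_ne_zero h2 h1 using 1
  push_cast
  module

/-- `R` is stable under the reflections in its non-isotropic elements. -/
lemma sub_smul_mem_roots {α β : Dual ℂ T.H} (hα : α ∈ T.nonisotropicRoots)
    (hβ : β ∈ T.roots) : β - T.cartanNumber β α • α ∈ T.roots := by
  obtain ⟨n, hn⟩ := T.exists_int_cartanNumber hα hβ
  rw [hn]
  obtain ⟨m, rfl | rfl⟩ := n.eq_nat_or_neg
  · simpa using T.sub_smul_mem_roots_of_nonneg hα hβ (by simpa using hn)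
  · have h1 : T.cartanNumber β (-α) = m := by
      have : T.cartanNumber β (-α) = -T.cartanNumber β α := by
        simp [SplitInvariantLie.cartanNumber, neg_div]
      rw [this, hn]; push_cast; ring
    simpa using T.sub_smul_mem_roots_of_nonneg (T.neg_mem_nonisotropicRoots hα) hβ h1

/-- Non-isotropic root spaces are one-dimensional. -/
lemma exists_eq_smul {α : Dual ℂ T.H} (hα : α ∈ T.nonisotropicRoots) {e x : E}
    (he : e ∈ T.rootSpace α) (he0 : e ≠ 0) (hx : x ∈ T.rootSpace α) : ∃ c : ℂ, x = c • e := by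
  obtain ⟨f, hf, t⟩ := T.exists_isSl2Triple hα he he0
  have hef : T.form e f ≠ 0 := by
    intro h
    have := T.lie_eq_form_smul_t he hf
    rw [h, zero_smul, t.lie_e_f] at this
    exact t.h_ne_zero this
  by_contra! hc
  set y := x - (T.form x f / T.form e f) • e with hy
  have hyα : y ∈ T.rootSpace α := Submodule.sub_mem _ hx (Submodule.smul_mem _ _ he)
  have hy0 : y ≠ 0 := fun h => hc _ (sub_eq_zero.1 h)
  have hyf : ⁅f, y⁆ = 0 := by
    have : T.form y f = 0 := by simp [hy, hef]
    rw [← lie_skew, T.lie_eq_form_smul_t hyα hf, this, zero_smul, neg_zero]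
  -- For the opposite triple `(-h, f, e)` the vector `y` is primitive of negative weight, which is
  -- impossible.
  have P : t.symm.HasPrimitiveVectorWith y (-2 : ℂ) :=
    ⟨hy0, by rw [neg_lie, T.lie_corootH α hyα, T.cartanNumber_self hα.2, neg_smul], hyf⟩
  obtain ⟨n, hn⟩ := P.exists_nat_of_pow_eq_zero (T.exists_toEnd_pow_eq_zero hα he y)
  have : (n : ℂ) + 2 = 0 := by rw [← hn]; ring
  exact_mod_cast this

/-- Brackets of non-isotropic root spaces are as large as possible. -/
lemma lie_ne_zero {α β : Dual ℂ T.H} (hα : α ∈ T.nonisotropicRoots)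
    (hβ : β ∈ T.nonisotropicRoots) (hαβ : α + β ∈ T.roots) {e x : E} (he : e ∈ T.rootSpace α)
    (he0 : e ≠ 0) (hx : x ∈ T.rootSpace β) (hx0 : x ≠ 0) : ⁅e, x⁆ ≠ 0 := by
  intro hex
  obtain ⟨f, hf, t⟩ := T.exists_isSl2Triple hα he he0
  have Px : t.HasPrimitiveVectorWith x (T.cartanNumber β α) := ⟨hx0, T.lie_corootH α hx, hex⟩
  obtain ⟨n, hn⟩ := Px.exists_nat_of_pow_eq_zero
    (T.exists_toEnd_pow_eq_zero (T.neg_mem_nonisotropicRoots hα) hf _)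
  obtain ⟨y, hy, hy0⟩ := T.exists_ne_zero_of_mem_roots hαβ
  obtain ⟨k, m, h, P⟩ := T.exists_primitive hα he hf t hy hy0
  have hm : m = n + 2 + 2 * k := by
    have h1 : T.cartanNumber (α + β) α = 2 + T.cartanNumber β α := by
      rw [← T.cartanNumber_self hα.2]
      simp only [SplitInvariantLie.cartanNumber, SplitInvariantLie.dualForm_add_left]; ring
    rw [h1, hn] at h
    have : (n : ℂ) + 2 + 2 * k = m := by push_cast at h; linear_combination h
    exact_mod_cast this.symm
  -- Going down from the top of the string through `E_{α+β}` reaches a non-zero vector of the line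
  -- `E_β`, hence a multiple of `x`. `e` should kill it, yet `e` maps it to `(k + 1) (m - k)` times
  -- a non-zero vector.
  have h1 := P.pow_toEnd_f_ne_zero_of_eq_nat rfl (i := k + 1) (by omega)
  have h2 := T.toEnd_pow_mem_rootSpace hf (T.toEnd_pow_mem_rootSpace he hy k) (k + 1)
  rw [show α + β + (k : ℂ) • α + ((k + 1 : ℕ) : ℂ) • -α = β by push_cast; module] at h2
  obtain ⟨c, hc⟩ := T.exists_eq_smul hβ hx hx0 h2
  have h3 := P.lie_e_pow_succ_toEnd_f k
  rw [hc, lie_smul, hex, smul_zero, eq_comm, smul_eq_zero, mul_eq_zero, sub_eq_zero] at h3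
  rcases h3 with (h3 | h3) | h3
  · exact Nat.cast_add_one_ne_zero k h3
  · have : m = k := by exact_mod_cast h3
    omega
  · exact P.pow_toEnd_f_ne_zero_of_eq_nat rfl (i := k) (by omega) h3

/-! ### Isotropic roots are orthogonal to all roots -/

/-- Since `(σ, σ) = 0`, the elements `x`, `y` and `[x, y] = t_σ` span a Heisenberg algebra, and
`t_σ` acts on the whole `σ`-string by the non-zero scalar `(α, σ)`. In such a module a vector killed
by `x` is never killed by a power of `y`. -/
lemma add_smul_mem_roots_or {α σ : Dual ℂ T.H} (hσ : σ ∈ T.isotropicRoots) (hα : α ∈ T.roots)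
    (hασ : T.dualForm α σ ≠ 0) :
    (∀ n : ℕ, α + (n : ℂ) • σ ∈ T.roots) ∨
      ∃ k : ℕ, ∀ n : ℕ, α + (k : ℂ) • σ + (n : ℂ) • -σ ∈ T.roots := by
  obtain ⟨x, hx, hx0⟩ := T.exists_ne_zero_of_mem_roots hσ.1
  obtain ⟨y, hy, hxy⟩ := T.exists_form_eq_one hx hx0
  obtain ⟨v, hv, hv0⟩ := T.exists_ne_zero_of_mem_roots hα
  by_cases hnil : ∃ n : ℕ, (LieModule.toEnd ℂ E E x ^ n) v = 0
  · obtain ⟨k, hk, hk'⟩ := Nat.exists_not_and_succ_of_not_zero_of_exists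
      (p := fun n => (LieModule.toEnd ℂ E E x ^ n) v = 0) hv0 hnil
    set u := (LieModule.toEnd ℂ E E x ^ k) v with hu
    have huk : u ∈ T.rootSpace (α + (k : ℂ) • σ) := T.toEnd_pow_mem_rootSpace hx hv k
    have hxu : ⁅x, u⁆ = 0 := by rwa [pow_succ', Module.End.mul_apply] at hk'
    have hlie : ⁅x, y⁆ = T.t σ := by rw [T.lie_eq_form_smul_t hx hy, hxy, one_smul]
    have hyn : ∀ n : ℕ, (LieModule.toEnd ℂ E E y ^ n) u ∈
        T.rootSpace (α + (k : ℂ) • σ + (n : ℂ) • -σ) := T.toEnd_pow_mem_rootSpace hy huk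
    have hcomm : ∀ n : ℕ, ⁅x, (LieModule.toEnd ℂ E E y ^ (n + 1)) u⁆ =
        ((n + 1) * T.dualForm α σ) • (LieModule.toEnd ℂ E E y ^ n) u := by
      intro n
      have hstep : ∀ n : ℕ, ⁅x, (LieModule.toEnd ℂ E E y ^ (n + 1)) u⁆ =
          T.dualForm α σ • (LieModule.toEnd ℂ E E y ^ n) u +
            ⁅y, ⁅x, (LieModule.toEnd ℂ E E y ^ n) u⁆⁆ := by
        intro n
        rw [pow_succ', Module.End.mul_apply, LieModule.toEnd_apply_apply, leibniz_lie, hlie,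
          (T.mem_rootSpace _ _).1 (hyn n), ← T.dualForm_eq']
        simp [hσ.2]
      induction n with
      | zero => rw [hstep]; simp [hxu]
      | succ n ih =>
        rw [hstep, ih, lie_smul, pow_succ', Module.End.mul_apply, LieModule.toEnd_apply_apply,
          ← add_smul]
        push_cast; congr 1; ring
    refine .inr ⟨k, fun n => T.mem_roots_of_ne_zero (hyn n) ?_⟩
    induction n with
    | zero => exact hk
    | succ n ih =>
      intro h0
      have := hcomm n
      rw [h0, lie_zero, eq_comm, smul_eq_zero, mul_eq_zero] at this
      exact this.elim (fun h => h.elim (Nat.cast_add_one_ne_zero n) hασ) ih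
  · push Not at hnil
    exact .inl fun n => T.mem_roots_of_ne_zero (T.toEnd_pow_mem_rootSpace hx hv n) (hnil n)

lemma not_forall_add_smul_mem_roots {α σ : Dual ℂ T.H} (hσ : σ ∈ T.isotropicRoots)
    (hασ : T.dualForm α σ ≠ 0) : ¬ ∀ n : ℕ, α + (n : ℂ) • σ ∈ T.roots := by
  intro h
  -- `n` is taken so large that `|(α + nσ, α + nσ)| > |2 (α, σ)|`. The Cartan integer of `σ` against
  -- `α + nσ` is then non-zero of modulus less than `1`.
  obtain ⟨n, hn⟩ := exists_nat_gt
    ((‖T.dualForm α α‖ + ‖2 * T.dualForm α σ‖) / ‖2 * T.dualForm α σ‖)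
  have hpos : 0 < ‖2 * T.dualForm α σ‖ := norm_pos_iff.2 (by simpa using hασ)
  rw [div_lt_iff₀ hpos] at hn
  have hnorm : T.dualForm (α + (n : ℂ) • σ) (α + (n : ℂ) • σ) =
      T.dualForm α α + n * (2 * T.dualForm α σ) := by
    simp [hσ.2, T.dualForm_comm σ α]; ring
  have hlt : ‖2 * T.dualForm α σ‖ < ‖T.dualForm (α + (n : ℂ) • σ) (α + (n : ℂ) • σ)‖ := by
    have h1 := norm_sub_le (T.dualForm α α + n * (2 * T.dualForm α σ)) (T.dualForm α α)
    rw [add_sub_cancel_left, norm_mul, Complex.norm_natCast] at h1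
    rw [hnorm]; linarith
  have hβ : α + (n : ℂ) • σ ∈ T.nonisotropicRoots :=
    ⟨h n, fun h0 => by rw [h0, norm_zero] at hlt; linarith⟩
  obtain ⟨m, hm⟩ := T.exists_int_cartanNumber hβ hσ.1
  have hval : T.dualForm σ (α + (n : ℂ) • σ) = T.dualForm α σ := by
    simp [hσ.2, T.dualForm_comm σ α]
  rw [SplitInvariantLie.cartanNumber, hval, div_eq_iff hβ.2] at hm
  have hm0 : m ≠ 0 := by
    rintro rfl
    rw [Int.cast_zero, zero_mul] at hm
    rw [hm, norm_zero] at hpos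
    exact lt_irrefl _ hpos
  have h1 : (1 : ℝ) ≤ ‖(m : ℂ)‖ := by
    rw [Complex.norm_intCast]
    exact_mod_cast Int.one_le_abs hm0
  rw [hm, norm_mul] at hlt
  nlinarith [norm_nonneg (T.dualForm (α + (n : ℂ) • σ) (α + (n : ℂ) • σ))]

/-- Isotropic roots are orthogonal to all roots. -/
lemma dualForm_isotropic_eq_zero {α σ : Dual ℂ T.H} (hσ : σ ∈ T.isotropicRoots)
    (hα : α ∈ T.roots) : T.dualForm α σ = 0 := by
  by_contra hασ
  rcases T.add_smul_mem_roots_or hσ hα hασ with h | ⟨k, h⟩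
  · exact T.not_forall_add_smul_mem_roots hσ hασ h
  · refine T.not_forall_add_smul_mem_roots (T.neg_mem_isotropicRoots hσ) ?_ h
    simpa [hσ.2] using hασ

lemma add_isotropic_mem_nonisotropicRoots {α σ : Dual ℂ T.H} (hσ : σ ∈ T.isotropicRoots)
    (hα : α ∈ T.nonisotropicRoots) (h : α + σ ∈ T.roots) : α + σ ∈ T.nonisotropicRoots := by
  refine ⟨h, ?_⟩
  simpa [hσ.2, T.dualForm_isotropic_eq_zero hσ hα.1, T.dualForm_comm σ α] using hα.2

end ExtendedAffineLie

/-! ### Chains of short roots in finite root systems. -/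

namespace RootPairing

variable {ι M N : Type*} [AddCommGroup M] [Module ℝ M] [AddCommGroup N] [Module ℝ N]
  (P : RootPairing ι ℝ M N)

/-- Two roots are linked if they span an `A₂` with angle `π / 3` between them. -/
def Linked (i j : ι) : Prop := P.pairing i j = 1 ∧ P.pairing j i = 1

open Relation

variable {P}

lemma Linked.symm {i j : ι} (h : P.Linked i j) : P.Linked j i := ⟨h.2, h.1⟩

lemma Linked.reflectionPerm {i j : ι} (h : P.Linked i j) (k : ι) :
    P.Linked (P.reflectionPerm k i) (P.reflectionPerm k j) := by
  constructor <;> rw [pairing_reflectionPerm, reflectionPerm_self]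
  exacts [h.1, h.2]

lemma transGen_linked_symm {i j : ι} (h : TransGen P.Linked i j) : TransGen P.Linked j i := by
  induction h with
  | single h => exact .single h.symm
  | tail _ h ih => exact .head h.symm ih

lemma transGen_linked_reflectionPerm {i j : ι} (h : TransGen P.Linked i j) (k : ι) :
    TransGen P.Linked (P.reflectionPerm k i) (P.reflectionPerm k j) := by
  induction h with
  | single h => exact .single (h.reflectionPerm k)
  | tail _ h ih => exact .tail ih (h.reflectionPerm k)

lemma pairing_reflectionPerm_left (i j k : ι) :
    P.pairing (P.reflectionPerm j i) k = P.pairing i k - P.pairing i j * P.pairing j k := by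
  rw [pairing, root', root_reflectionPerm, reflection_apply_root]
  simp

lemma pairing_reflectionPerm_right (i j k : ι) :
    P.pairing k (P.reflectionPerm j i) = P.pairing k i - P.pairing k j * P.pairing j i := by
  rw [pairing_reflectionPerm, pairing_reflectionPerm_left]

lemma reflectionPerm_reflectionPerm (i j k : ι) :
    P.reflectionPerm (P.reflectionPerm j i) k =
      P.reflectionPerm j (P.reflectionPerm i (P.reflectionPerm j k)) :=
  P.root.injective <| by simp [root_reflectionPerm, reflection_reflectionPerm]

/-- The hexagon of the six roots of an `A₂`. -/
lemma transGen_linked_of_pairing_eq_neg_one {i j : ι} (hij : P.pairing i j = -1)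
    (hji : P.pairing j i = -1) :
    TransGen P.Linked i i ∧ TransGen P.Linked i j ∧
      TransGen P.Linked i (P.reflectionPerm i i) ∧
      TransGen P.Linked i (P.reflectionPerm j i) := by
  have h1 : P.Linked i (P.reflectionPerm j i) := by
    constructor <;> simp [pairing_reflectionPerm_left, pairing_reflectionPerm_right, hij, hji] <;>
      norm_num
  have h2 : P.Linked (P.reflectionPerm j i) j := by
    constructor <;> simp [pairing_reflectionPerm_left, pairing_reflectionPerm_right, hij, hji] <;>
      norm_num
  have h3 : P.Linked j (P.reflectionPerm i i) := by
    constructor <;> simp [hij, hji]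
  exact ⟨.trans (.single h1) (.single h1.symm), .trans (.single h1) (.single h2),
    .trans (.trans (.single h1) (.single h2)) (.single h3), .single h1⟩

variable (P) in
/-- `K` is a reflection-invariant connected class of roots for the relation `Linked`, and every root
outside `K` is the sum of two elements of `K`. -/
structure IsLinkedClass (K : Set ι) : Prop where
  nonempty : K.Nonempty
  transGen : ∀ i ∈ K, ∀ j ∈ K, TransGen P.Linked i j
  reflectionPerm_mem : ∀ i ∈ K, ∀ k, P.reflectionPerm k i ∈ K
  exists_pairing_eq_one : ∀ i ∉ K, ∃ j ∈ K, P.pairing j i = 1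

/-- Reflections preserve links, so a simple reflection preserves the class of `i₀` as soon as it
keeps `i₀` in it; `hrefl` puts the image in the `A₂` of `i₀` and `j₀`. Simple reflections generate
the Weyl group, and every root is conjugate to a simple one, which reduces the remaining claim to
`hlong`. -/
theorem exists_isLinkedClass_of_simple [Finite ι] [P.IsCrystallographic] [P.IsReduced] (b : P.Base)
    {i₀ j₀ : ι} (h₀ : P.pairing i₀ j₀ = -1) (h₀' : P.pairing j₀ i₀ = -1)
    (hrefl : ∀ k ∈ b.support, P.reflectionPerm k i₀ ∈
      ({i₀, j₀, P.reflectionPerm i₀ i₀, P.reflectionPerm j₀ i₀} : Set ι))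
    (hlong : ∀ k ∈ b.support, TransGen P.Linked i₀ k ∨
      ∃ j, TransGen P.Linked i₀ j ∧ P.pairing j k = -1) :
    ∃ K : Set ι, P.IsLinkedClass K := by
  obtain ⟨h1, h2, h3, h4⟩ := transGen_linked_of_pairing_eq_neg_one h₀ h₀'
  have hrest : ∀ k ∈ b.support, ∀ i, TransGen P.Linked i₀ i →
      TransGen P.Linked i₀ (P.reflectionPerm k i) := by
    intro k hk i hi
    refine TransGen.trans ?_ (transGen_linked_reflectionPerm hi k)
    rcases hrefl k hk with h | h | h | h <;> rw [h] <;> assumption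
  have hK : ∀ k i, TransGen P.Linked i₀ i → TransGen P.Linked i₀ (P.reflectionPerm k i) := by
    intro k
    refine b.induction_reflect k
      (p := fun k => ∀ i, TransGen P.Linked i₀ i → TransGen P.Linked i₀ (P.reflectionPerm k i))
      ?_ ?_ ?_
    · intro k hk i hi
      rw [reflectionPerm_reflectionPerm, reflectionPerm_self]
      exact hk i hi
    · exact hrest
    · intro k l hk hl i hi
      rw [reflectionPerm_reflectionPerm]
      exact hrest l hl _ (hk _ (hrest l hl _ hi))
  refine ⟨{i | TransGen P.Linked i₀ i}, ⟨i₀, h1⟩,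
    fun i hi j hj => (transGen_linked_symm hi).trans hj, fun i hi k => hK k i hi, fun i => ?_⟩
  refine b.induction_reflect i
    (p := fun i => ¬ TransGen P.Linked i₀ i → ∃ j, TransGen P.Linked i₀ j ∧ P.pairing j i = 1)
    ?_ ?_ ?_
  · intro i h hi
    obtain ⟨j, hj, hji⟩ := h fun hi' => hi (hK _ _ hi')
    exact ⟨P.reflectionPerm i j, hK _ _ hj, by rwa [pairing_reflectionPerm, reflectionPerm_self]⟩
  · intro i hi hi'
    obtain h | ⟨j, hj, hji⟩ := hlong i hi
    · exact absurd h hi'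
    · exact ⟨P.reflectionPerm i j, hK _ _ hj, by
        rw [← pairing_reflectionPerm, pairing_reflectionPerm_self_right, hji, neg_neg]⟩
  · intro i k h hk hi
    obtain ⟨j, hj, hji⟩ := h fun hi' => hi (hK _ _ hi')
    exact ⟨P.reflectionPerm k j, hK _ _ hj, by rwa [pairing_reflectionPerm, reflectionPerm_self]⟩

lemma pairing_eq_cartanMatrix {n : ℕ} {A : Matrix (Fin n) (Fin n) ℤ} [P.IsCrystallographic]
    {b : P.Base} {e : b.support ≃ Fin n} (h : ∀ i j, b.cartanMatrix i j = A (e i) (e j))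
    (i j : Fin n) : P.pairing (e.symm i) (e.symm j) = A i j := by
  rw [← b.algebraMap_cartanMatrixIn_apply ℤ,
    show b.cartanMatrixIn ℤ (e.symm i) (e.symm j) = A i j by simpa using h (e.symm i) (e.symm j)]
  simp

/-- In a root system of type `C_ℓ` (`ℓ ≥ 3`), `F₄` or `G₂`, the short roots form a linked class. -/
theorem exists_isLinkedClass [Finite ι] [P.IsCrystallographic] [P.IsReduced] (b : P.Base) {n : ℕ}
    {A : Matrix (Fin n) (Fin n) ℤ} (e : b.support ≃ Fin n)
    (h : ∀ i j, b.cartanMatrix i j = A (e i) (e j))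
    (hA : (3 ≤ n ∧ A = CartanMatrix.C n) ∨ (∃ hn : n = 4, A = hn ▸ CartanMatrix.F₄) ∨
      ∃ hn : n = 2, A = hn ▸ CartanMatrix.G₂) : ∃ K : Set ι, P.IsLinkedClass K := by
  have hs := pairing_eq_cartanMatrix h
  have hsupp : ∀ p : ι → Prop, (∀ a, p (e.symm a)) → ∀ k ∈ b.support, p k := by
    intro p hp k hk
    simpa using hp (e ⟨k, hk⟩)
  rcases hA with ⟨hn, rfl⟩ | ⟨rfl, rfl⟩ | ⟨rfl, rfl⟩
  -- Type `C`: the simple roots `0, …, n - 2` are short and form a chain; the long root `n - 1` is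
  -- adjacent to `n - 2`.
  · have hC : ∀ (a b : Fin n) (c : ℤ), CartanMatrix.C n a b = c →
        P.pairing (e.symm a) (e.symm b) = c := fun a b c hc => by rw [hs, hc]
    have h01 : P.pairing (e.symm ⟨0, by omega⟩) (e.symm ⟨1, by omega⟩) = -1 := by
      simpa using hC ⟨0, _⟩ ⟨1, _⟩ (-1) (by simp [CartanMatrix.C])
    have h10 : P.pairing (e.symm ⟨1, by omega⟩) (e.symm ⟨0, by omega⟩) = -1 := by
      simpa using hC ⟨1, _⟩ ⟨0, _⟩ (-1) (by simp [CartanMatrix.C]; omega)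
    have hchain : ∀ a (ha : a + 1 < n),
        TransGen P.Linked (e.symm ⟨0, by omega⟩) (e.symm ⟨a, by omega⟩) := by
      intro a
      induction a with
      | zero => exact fun _ => (transGen_linked_of_pairing_eq_neg_one h01 h10).1
      | succ a ih =>
        intro ha
        refine (ih (by omega)).trans (transGen_linked_of_pairing_eq_neg_one ?_ ?_).2.1
        · simpa using hC ⟨a, _⟩ ⟨a + 1, _⟩ (-1) (by simp [CartanMatrix.C])
        · simpa using hC ⟨a + 1, _⟩ ⟨a, _⟩ (-1) (by simp [CartanMatrix.C]; omega)
    refine exists_isLinkedClass_of_simple b h01 h10 (hsupp _ fun a => ?_) (hsupp _ fun a => ?_)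
    · by_cases h0 : a = ⟨0, by omega⟩
      · simp [h0]
      by_cases h1 : a = ⟨1, by omega⟩
      · simp [h1]
      refine .inl (P.reflectionPerm_eq_of_pairing_eq_zero ?_)
      · simp only [Fin.ext_iff] at h0 h1
        refine (hC _ a 0 ?_).trans Int.cast_zero
        simp only [CartanMatrix.C, Matrix.of_apply, Fin.ext_iff]
        split_ifs <;> omega
    · by_cases ha : a.val + 1 < n
      · exact .inl (hchain a ha)
      · refine .inr ⟨_, hchain (n - 2) (by omega), ?_⟩
        refine (hC _ a (-1) ?_).trans (by simp)
        have := a.isLt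
        simp only [CartanMatrix.C, Matrix.of_apply, Fin.ext_iff]
        split_ifs <;> omega
  -- Type `F₄`: roots `2` and `3` are short. Root `0` is orthogonal to both, so its partner is the
  -- reflection of root `2` in root `1`, which fixes root `3`.
  · have h01 : P.pairing (e.symm 3) (e.symm 2) = -1 := by rw [hs]; simp [CartanMatrix.F₄]
    have h10 : P.pairing (e.symm 2) (e.symm 3) = -1 := by rw [hs]; simp [CartanMatrix.F₄]
    have hA2 := transGen_linked_of_pairing_eq_neg_one h01 h10
    have h31 : P.reflectionPerm (e.symm 1) (e.symm 3) = e.symm 3 :=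
      P.reflectionPerm_eq_of_pairing_eq_zero (by rw [hs]; simp [CartanMatrix.F₄])
    refine exists_isLinkedClass_of_simple b h01 h10 (hsupp _ fun a => ?_) (hsupp _ fun a => ?_)
    · fin_cases a
      · simp [reflectionPerm_eq_of_pairing_eq_zero, hs, CartanMatrix.F₄]
      · simp [h31]
      · simp
      · simp
    · fin_cases a
      · refine .inr ⟨P.reflectionPerm (e.symm 1) (e.symm 2), ?_, ?_⟩
        · simpa [h31] using transGen_linked_reflectionPerm hA2.2.1 (e.symm 1)
        · simp [pairing_reflectionPerm_left, hs, CartanMatrix.F₄]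
      · exact .inr ⟨_, hA2.2.1, by simp [hs, CartanMatrix.F₄]⟩
      · exact .inl hA2.2.1
      · exact .inl hA2.1
  -- Type `G₂`: only one simple root is short, so its `A₂` partner is its reflection in the long
  -- one.
  · have h01 : P.pairing (e.symm 1) (P.reflectionPerm (e.symm 0) (e.symm 1)) = -1 := by
      rw [pairing_reflectionPerm_right]; simp [hs, CartanMatrix.G₂]; norm_num
    have h10 : P.pairing (P.reflectionPerm (e.symm 0) (e.symm 1)) (e.symm 1) = -1 := by
      rw [pairing_reflectionPerm_left]; simp [hs, CartanMatrix.G₂]; norm_num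
    have hA2 := transGen_linked_of_pairing_eq_neg_one h01 h10
    refine exists_isLinkedClass_of_simple b h01 h10 (hsupp _ fun a => ?_) (hsupp _ fun a => ?_)
    · fin_cases a <;> simp
    · fin_cases a
      · exact .inr ⟨_, hA2.1, by simp [hs, CartanMatrix.G₂]⟩
      · exact .inl hA2.1

end RootPairing

namespace ExtendedAffineLie

variable {E : Type*} [LieRing E] [LieAlgebra ℂ E] (T : ExtendedAffineLie E)

open Relation SplitInvariantLie

lemma sub_mem_roots_of_cartanNumber_eq_one {α β : Dual ℂ T.H} (hα : α ∈ T.nonisotropicRoots)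
    (hβ : β ∈ T.roots) (h : T.cartanNumber β α = 1) : β - α ∈ T.roots := by
  simpa [h] using T.sub_smul_mem_roots hα hβ

/-! ### Comparison with the finite root system -/

variable {T} in
/-- The image of a root in `V̄`. -/
def toBar {α : Dual ℂ T.H} (hα : α ∈ T.roots) : T.Vbar :=
  T.V0.mkQ ⟨α, Submodule.subset_span hα⟩

/-- The real functional `v ↦ 2 (v, α) / (α, α)` on `V`. -/
def corootV (α : Dual ℂ T.H) : Dual ℝ T.V :=
  Complex.reLm ∘ₗ ((Dual.eval ℂ T.H (T.corootH α)).restrictScalars ℝ) ∘ₗ T.V.subtype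

lemma corootV_apply (α : Dual ℂ T.H) (v : T.V) :
    T.corootV α v = ((v : Dual ℂ T.H) (T.corootH α)).re := rfl

lemma V0_le_ker_corootV {α : Dual ℂ T.H} (hα : α ∈ T.roots) :
    T.V0 ≤ LinearMap.ker (T.corootV α) := by
  intro v hv
  have hv' : (v : Dual ℂ T.H) ∈ Submodule.span ℝ T.isotropicRoots := hv
  rw [LinearMap.mem_ker, corootV_apply]
  suffices (v : Dual ℂ T.H) (T.corootH α) = 0 by rw [this, Complex.zero_re]
  generalize (v : Dual ℂ T.H) = w at hv'
  induction hv' using Submodule.span_induction with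
  | mem w hw =>
    rw [apply_corootH, cartanNumber, dualForm_comm, T.dualForm_isotropic_eq_zero hw hα]
    simp
  | zero => rfl
  | add x y _ _ hx hy => rw [LinearMap.add_apply, hx, hy, add_zero]
  | smul r x _ hx => rw [LinearMap.smul_apply, hx, smul_zero]

variable {T} in
/-- The real functional `v ↦ 2 (v, α) / (α, α)` on `V̄`. -/
def corootVbar {α : Dual ℂ T.H} (hα : α ∈ T.roots) : Dual ℝ T.Vbar :=
  T.V0.liftQ (T.corootV α) (T.V0_le_ker_corootV hα)

lemma corootVbar_toBar {α β : Dual ℂ T.H} (hα : α ∈ T.roots) (hβ : β ∈ T.roots) :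
    corootVbar hα (toBar hβ) = (T.cartanNumber β α).re := by
  rw [toBar, corootVbar, Submodule.mkQ_apply, Submodule.liftQ_apply, corootV_apply, apply_corootH]

lemma corootVbar_toBar_self {α : Dual ℂ T.H} (hα : α ∈ T.nonisotropicRoots) :
    corootVbar hα.1 (toBar hα.1) = 2 := by
  rw [corootVbar_toBar, T.cartanNumber_self hα.2]; rfl

lemma toBar_mem_barRoots {α : Dual ℂ T.H} (hα : α ∈ T.nonisotropicRoots) :
    toBar hα.1 ∈ T.barRoots := by
  refine ⟨fun h => ?_, ⟨α, Submodule.subset_span hα.1⟩, hα.1, rfl⟩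
  have := T.corootVbar_toBar_self hα
  rw [h, map_zero] at this
  norm_num at this

lemma exists_toBar_eq {v : T.Vbar} (hv : v ∈ T.barRoots) :
    ∃ (α : Dual ℂ T.H) (hα : α ∈ T.nonisotropicRoots), toBar hα.1 = v := by
  obtain ⟨hv0, α, hα, rfl⟩ := hv
  rcases T.isotropic_or_nonisotropic hα with h | h
  · have : α ∈ T.V0 := Submodule.subset_span h
    exact absurd ((Submodule.Quotient.mk_eq_zero T.V0).2 this) hv0
  · exact ⟨α, h, rfl⟩

lemma toBar_sub_smul {α β : Dual ℂ T.H} (hα : α ∈ T.nonisotropicRoots) (hβ : β ∈ T.roots) :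
    toBar (T.sub_smul_mem_roots hα hβ) =
      toBar hβ - corootVbar hα.1 (toBar hβ) • toBar hα.1 := by
  rw [corootVbar_toBar]
  obtain ⟨n, hn⟩ := T.exists_int_cartanNumber hα hβ
  simp only [toBar, hn, Complex.intCast_re, ← map_smul, ← map_sub]
  congr 1

lemma mapsTo_preReflection_corootVbar {α : Dual ℂ T.H} (hα : α ∈ T.nonisotropicRoots) :
    Set.MapsTo (preReflection (toBar hα.1) (corootVbar hα.1)) T.barRoots T.barRoots := by
  intro v hv
  refine ⟨fun h => ?_, ?_⟩
  · have := involutive_preReflection (T.corootVbar_toBar_self hα) v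
    rw [h, map_zero] at this
    exact hv.1 this.symm
  · obtain ⟨β, hβ, rfl⟩ := T.exists_toBar_eq hv
    exact ⟨⟨_, Submodule.subset_span (T.sub_smul_mem_roots hα hβ.1)⟩, T.sub_smul_mem_roots hα hβ.1,
      T.toBar_sub_smul hα hβ.1⟩

variable {T} in
/-- The index of the finite root system given by a non-isotropic root. -/
def barIndex {α : Dual ℂ T.H} (hα : α ∈ T.nonisotropicRoots) : T.barRoots :=
  ⟨toBar hα.1, T.toBar_mem_barRoots hα⟩

section RootPairing

variable {P : RootPairing T.barRoots ℝ T.Vbar (Dual ℝ T.Vbar)} [P.IsRootSystem]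

-- The coroots of `P` are not prescribed, but in a finite spanning set a root determines the
-- functional whose reflection preserves the set. This ties the pairing of `P` to the form on `E`.
include P in
lemma coroot'_barIndex (hfin : T.barRoots.Finite) (hP : ∀ i, P.root i = i)
    {α : Dual ℂ T.H} (hα : α ∈ T.nonisotropicRoots) :
    P.coroot' (barIndex hα) = corootVbar hα.1 := by
  have hrange : Set.range P.root = T.barRoots := by
    ext v
    simp [hP]
  have hroot : P.root (barIndex hα) = toBar hα.1 := hP _
  refine Dual.eq_of_preReflection_mapsTo (x := toBar hα.1) hfin ?_ ?_ ?_
    (T.corootVbar_toBar_self hα) (T.mapsTo_preReflection_corootVbar hα)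
  · rw [← hrange]; exact RootPairing.IsRootSystem.span_root_eq_top
  · rw [← hroot]; exact P.root_coroot_two _
  · rw [← hroot]
    have := P.mapsTo_reflection_root (barIndex hα)
    rwa [hrange] at this

lemma pairing_barIndex (hfin : T.barRoots.Finite) (hP : ∀ i, P.root i = i)
    {α β : Dual ℂ T.H} (hα : α ∈ T.nonisotropicRoots) (hβ : β ∈ T.nonisotropicRoots) :
    (P.pairing (barIndex hβ) (barIndex hα) : ℂ) = T.cartanNumber β α := by
  have h : P.pairing (barIndex hβ) (barIndex hα) = (T.cartanNumber β α).re := by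
    rw [← P.root_coroot'_eq_pairing, T.coroot'_barIndex hfin hP, hP, ← T.corootVbar_toBar hα.1 hβ.1]
    rfl
  obtain ⟨n, hn⟩ := T.exists_int_cartanNumber hα hβ.1
  rw [h, hn]
  simp

end RootPairing

lemma reflection_mem_nonisotropicRoots {α β : Dual ℂ T.H} (hα : α ∈ T.nonisotropicRoots)
    (hβ : β ∈ T.nonisotropicRoots) : β - T.cartanNumber β α • α ∈ T.nonisotropicRoots := by
  refine ⟨T.sub_smul_mem_roots hα hβ.1, ?_⟩
  have h := hα.2
  convert hβ.2 using 1
  simp only [cartanNumber, dualForm_sub_left, dualForm_sub_right, dualForm_smul_left,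
    dualForm_smul_right, T.dualForm_comm α β]
  field_simp
  ring

lemma barIndex_reflection {P : RootPairing T.barRoots ℝ T.Vbar (Dual ℝ T.Vbar)} [P.IsRootSystem]
    (hfin : T.barRoots.Finite) (hP : ∀ i, P.root i = i)
    {α β : Dual ℂ T.H} (hα : α ∈ T.nonisotropicRoots) (hβ : β ∈ T.nonisotropicRoots) :
    barIndex (T.reflection_mem_nonisotropicRoots hα hβ) =
      P.reflectionPerm (barIndex hα) (barIndex hβ) := by
  apply P.root.injective
  rw [P.root_reflectionPerm, P.reflection_apply, T.coroot'_barIndex hfin hP, hP, hP, hP]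
  exact T.toBar_sub_smul hα hβ.1

/-- Two non-isotropic roots with both Cartan integers equal to `1`. -/
def Linked (α β : Dual ℂ T.H) : Prop :=
  α ∈ T.nonisotropicRoots ∧ β ∈ T.nonisotropicRoots ∧ T.cartanNumber α β = 1 ∧
    T.cartanNumber β α = 1

/-- Cartan numbers depend only on images in `V̄`, so a chain lifts through arbitrary preimages, with
any prescribed lift of its endpoint. -/
lemma transGen_linked_of_barIndex {P : RootPairing T.barRoots ℝ T.Vbar (Dual ℝ T.Vbar)}
    [P.IsRootSystem] (hfin : T.barRoots.Finite) (hP : ∀ i, P.root i = i)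
    {α : Dual ℂ T.H} (hα : α ∈ T.nonisotropicRoots) {i : T.barRoots}
    (h : TransGen P.Linked (barIndex hα) i) :
    ∀ {β : Dual ℂ T.H} (hβ : β ∈ T.nonisotropicRoots), barIndex hβ = i →
      TransGen T.Linked α β := by
  have key : ∀ {β γ : Dual ℂ T.H} (hβ : β ∈ T.nonisotropicRoots) (hγ : γ ∈ T.nonisotropicRoots),
      P.Linked (barIndex hβ) (barIndex hγ) → T.Linked β γ := fun hβ hγ h =>
    ⟨hβ, hγ, by rw [← T.pairing_barIndex hfin hP hγ hβ, h.1, Complex.ofReal_one],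
      by rw [← T.pairing_barIndex hfin hP hβ hγ, h.2, Complex.ofReal_one]⟩
  induction h with
  | single h =>
    rintro β hβ rfl
    exact .single (key hα hβ h)
  | @tail j k _ h ih =>
    rintro β hβ rfl
    obtain ⟨γ, hγ, hγj⟩ := T.exists_toBar_eq j.2
    have hγj' : barIndex hγ = j := Subtype.ext hγj
    exact .tail (ih hγ hγj') (key hγ hβ (hγj' ▸ h))

/-- A set of roots with the properties of the set of short roots in types `C_ℓ` (`ℓ ≥ 3`), `F₄` and
`G₂`: it is connected under `Linked`, and every other non-isotropic root is a sum of two of its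
elements. -/
structure IsShortClass (K : Set (Dual ℂ T.H)) : Prop where
  subset : K ⊆ T.nonisotropicRoots
  nonempty : K.Nonempty
  transGen : ∀ α ∈ K, ∀ β ∈ K, TransGen T.Linked α β
  exists_sub_mem : ∀ α ∈ T.nonisotropicRoots, α ∉ K →
    ∃ β ∈ K, T.cartanNumber β α = 1 ∧ α - β ∈ K

theorem exists_isShortClass
    (hX : (∃ ℓ : ℕ, 3 ≤ ℓ ∧ T.HasCartanType (CartanMatrix.C ℓ)) ∨
      T.HasCartanType CartanMatrix.F₄ ∨ T.HasCartanType CartanMatrix.G₂) :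
    ∃ K, T.IsShortClass K := by
  obtain ⟨n, A, hA, P, _, hfin, _, _, hP, b, e, he⟩ : ∃ (n : ℕ) (A : Matrix (Fin n) (Fin n) ℤ),
      ((3 ≤ n ∧ A = CartanMatrix.C n) ∨ (∃ hn : n = 4, A = hn ▸ CartanMatrix.F₄) ∨
        ∃ hn : n = 2, A = hn ▸ CartanMatrix.G₂) ∧ T.HasCartanType A := by
    rcases hX with ⟨ℓ, hℓ, h⟩ | h | h
    · exact ⟨ℓ, _, .inl ⟨hℓ, rfl⟩, h⟩
    · exact ⟨4, _, .inr (.inl ⟨rfl, rfl⟩), h⟩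
    · exact ⟨2, _, .inr (.inr ⟨rfl, rfl⟩), h⟩
  have : Finite T.barRoots := hfin
  obtain ⟨K, hK⟩ := RootPairing.exists_isLinkedClass b e he hA
  refine ⟨{α | ∃ hα : α ∈ T.nonisotropicRoots, barIndex hα ∈ K}, fun α h => h.1, ?_, ?_, ?_⟩
  · obtain ⟨i, hi⟩ := hK.nonempty
    obtain ⟨α, hα, hαi⟩ := T.exists_toBar_eq i.2
    have : barIndex hα = i := Subtype.ext hαi
    exact ⟨α, hα, this ▸ hi⟩
  · rintro α ⟨hα, hαK⟩ β ⟨hβ, hβK⟩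
    exact T.transGen_linked_of_barIndex hfin hP hα (hK.transGen _ hαK _ hβK) hβ rfl
  · intro α hα hαK
    obtain ⟨j, hj, hjα⟩ := hK.exists_pairing_eq_one (barIndex hα) fun h => hαK ⟨hα, h⟩
    obtain ⟨β, hβ, hβj⟩ := T.exists_toBar_eq j.2
    obtain rfl : barIndex hβ = j := Subtype.ext hβj
    have h1 : T.cartanNumber β α = 1 := by
      rw [← T.pairing_barIndex hfin hP hα hβ, hjα, Complex.ofReal_one]
    refine ⟨β, ⟨hβ, hj⟩, h1, ?_⟩
    have key : ∀ γ δ, γ ∈ T.nonisotropicRoots → (∃ h : δ ∈ T.nonisotropicRoots, barIndex h ∈ K) →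
        ∃ h : δ - T.cartanNumber δ γ • γ ∈ T.nonisotropicRoots, barIndex h ∈ K := by
      rintro γ δ hγ ⟨hδ, hδK⟩
      exact ⟨T.reflection_mem_nonisotropicRoots hγ hδ, by
        rw [T.barIndex_reflection hfin hP hγ hδ]; exact hK.reflectionPerm_mem _ hδK _⟩
    -- Reflecting `β` in `α` gives `β - α`; reflecting that in itself gives `α - β`.
    have h2 := key α β hα ⟨hβ, hj⟩
    rw [h1, one_smul] at h2
    have h3 := key _ _ h2.1 h2
    rwa [T.cartanNumber_self h2.1.2, two_smul,
      show β - α - (β - α + (β - α)) = α - β by abel] at h3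

end ExtendedAffineLie

namespace ExtendedAffineLie

variable {E : Type*} [LieRing E] [LieAlgebra ℂ E] (T : ExtendedAffineLie E)

open Relation SplitInvariantLie

/-! ### Isotropic roots are differences of non-isotropic ones -/

lemma lie_eq_zero_of_mem_core {x : E}
    (hx : ∀ α ∈ T.nonisotropicRoots, ∀ y ∈ T.rootSpace α, ⁅x, y⁆ = 0) {y : E} (hy : y ∈ T.core) :
    ⁅x, y⁆ = 0 := by
  let C : LieSubalgebra ℂ E :=
    { LinearMap.ker (LieAlgebra.ad ℂ E x) with
      lie_mem' := by
        intro a b ha hb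
        change ⁅x, a⁆ = 0 at ha
        change ⁅x, b⁆ = 0 at hb
        change ⁅x, ⁅a, b⁆⁆ = 0
        rw [leibniz_lie, ha, hb, zero_lie, lie_zero, add_zero] }
  have hle : T.core ≤ C := by
    refine LieSubalgebra.lieSpan_le.2 fun y hy => ?_
    simp only [Set.mem_iUnion] at hy
    obtain ⟨α, hα, hy⟩ := hy
    exact hx α hα y hy
  exact hle hy

/-- No isotropic root is isolated. -/
lemma exists_add_mem_roots {σ : Dual ℂ T.H}
    (hσ : σ ∈ T.isotropicRoots) : ∃ α ∈ T.nonisotropicRoots, α + σ ∈ T.roots := by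
  by_contra! hc
  obtain ⟨x, hx, hx0⟩ := T.exists_ne_zero_of_mem_roots hσ.1
  obtain ⟨y, hy, hxy⟩ := T.exists_form_eq_one hx hx0
  -- If no `α + σ` is a root, `x` and `y` both centralize the core, so tameness puts `y` in it. But
  -- `x` is orthogonal to the core: to its generators by weights, to brackets by invariance. This
  -- contradicts `(x, y) = 1`.
  have hxc : ∀ z ∈ T.core, ⁅x, z⁆ = 0 := by
    refine fun z hz => T.lie_eq_zero_of_mem_core (fun α hα z hz => ?_) hz
    refine T.eq_zero_of_notMem_roots (hc α hα) ?_
    rw [add_comm]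
    exact T.lie_mem_rootSpace hx hz
  have hyc : y ∈ T.core := by
    refine T.tame y fun z hz => T.lie_eq_zero_of_mem_core (fun α hα z hz => ?_) hz
    refine T.eq_zero_of_notMem_roots (α := α - σ) (fun h => ?_) ?_
    · refine hc (-α) (T.neg_mem_nonisotropicRoots hα) ?_
      simpa [add_comm, sub_eq_add_neg] using T.neg_mem_roots h
    · rw [sub_eq_add_neg, add_comm]
      exact T.lie_mem_rootSpace hy hz
  let O : LieSubalgebra ℂ E :=
    { T.core.toSubmodule ⊓ LinearMap.ker (T.form x) with
      lie_mem' := by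
        rintro a b ⟨ha, -⟩ ⟨hb, -⟩
        refine ⟨T.core.lie_mem ha hb, ?_⟩
        rw [SetLike.mem_coe, LinearMap.mem_ker, T.form_lie_right, hxc a ha, map_zero,
          LinearMap.zero_apply] }
  have hle : T.core ≤ O := by
    refine LieSubalgebra.lieSpan_le.2 fun z hz => ⟨LieSubalgebra.subset_lieSpan hz, ?_⟩
    simp only [Set.mem_iUnion] at hz
    obtain ⟨α, hα, hz⟩ := hz
    refine T.form_eq_zero_of_add_ne_zero (fun h => hα.2 ?_) hx hz
    rw [eq_neg_of_add_eq_zero_right h]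
    simpa using hσ.2
  have : T.form x y = 0 := (hle hyc).2
  rw [hxy] at this
  exact one_ne_zero this

/-! ### Shifts of roots by isotropic roots -/

section Shift

variable {T}

lemma cartanNumber_add_isotropic_left {α β σ : Dual ℂ T.H} (hσ : σ ∈ T.isotropicRoots)
    (hα : α ∈ T.roots) : T.cartanNumber (β + σ) α = T.cartanNumber β α := by
  simp [cartanNumber, T.dualForm_comm σ α, T.dualForm_isotropic_eq_zero hσ hα]

lemma cartanNumber_add_isotropic_right {α β σ : Dual ℂ T.H} (hσ : σ ∈ T.isotropicRoots)
    (hα : α ∈ T.roots) (hβ : β ∈ T.roots) :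
    T.cartanNumber β (α + σ) = T.cartanNumber β α := by
  simp [cartanNumber, T.dualForm_comm σ α, T.dualForm_isotropic_eq_zero hσ hα,
    T.dualForm_isotropic_eq_zero hσ hβ, hσ.2]

lemma Linked.two_mul_dualForm {α β : Dual ℂ T.H} (h : T.Linked α β) :
    2 * T.dualForm α β = T.dualForm β β ∧ 2 * T.dualForm α β = T.dualForm α α := by
  obtain ⟨hα, hβ, h1, h2⟩ := h
  rw [cartanNumber, div_eq_one_iff_eq hβ.2] at h1
  rw [cartanNumber, div_eq_one_iff_eq hα.2, T.dualForm_comm] at h2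
  exact ⟨h1, h2⟩

lemma Linked.sub_mem {α β : Dual ℂ T.H} (h : T.Linked α β) : β - α ∈ T.nonisotropicRoots := by
  refine ⟨T.sub_mem_roots_of_cartanNumber_eq_one h.1 h.2.1.1 h.2.2.2, ?_⟩
  obtain ⟨h1, h2⟩ := h.two_mul_dualForm
  have h3 := h.1.2
  rw [← h2] at h3
  simp only [dualForm_sub_left, dualForm_sub_right, T.dualForm_comm β α]
  convert h3 using 1
  rw [← h1, ← h2]
  ring

/-- Reflection in `α - β` sends `α + σ` to `β + σ`. -/
lemma Linked.add_isotropic_mem {α β σ : Dual ℂ T.H} (h : T.Linked α β)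
    (hσ : σ ∈ T.isotropicRoots) (hασ : α + σ ∈ T.roots) : β + σ ∈ T.roots := by
  have hγ : α - β ∈ T.nonisotropicRoots := by simpa using T.neg_mem_nonisotropicRoots h.sub_mem
  have h1 : T.cartanNumber (α + σ) (α - β) = 1 := by
    rw [cartanNumber_add_isotropic_left hσ hγ.1, cartanNumber, div_eq_one_iff_eq hγ.2]
    obtain ⟨h1, h2⟩ := h.two_mul_dualForm
    simp only [dualForm_sub_left, dualForm_sub_right, T.dualForm_comm β α]
    rw [← h1, ← h2]
    ring
  have := T.sub_mem_roots_of_cartanNumber_eq_one hγ hασ h1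
  rwa [show α + σ - (α - β) = β + σ by abel] at this

lemma IsShortClass.add_isotropic_mem {K : Set (Dual ℂ T.H)} (hK : T.IsShortClass K)
    {α σ : Dual ℂ T.H} (hα : α ∈ K) (hσ : σ ∈ T.isotropicRoots) : α + σ ∈ T.roots := by
  obtain ⟨γ, hγ, hγσ⟩ : ∃ γ ∈ K, γ + σ ∈ T.roots := by
    obtain ⟨γ, hγ, hγσ⟩ := T.exists_add_mem_roots hσ
    by_cases hγK : γ ∈ K
    · exact ⟨γ, hγK, hγσ⟩
    · obtain ⟨β, hβ, hβγ, hsub⟩ := hK.exists_sub_mem γ hγ hγK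
      -- Reflecting `β` in `γ + σ` and negating gives `(γ - β) + σ`, with `γ - β` in `K`.
      refine ⟨_, hsub, ?_⟩
      have h1 : T.cartanNumber β (γ + σ) = 1 := by
        rw [cartanNumber_add_isotropic_right hσ hγ.1 (hK.subset hβ).1, hβγ]
      have := T.neg_mem_roots (T.sub_mem_roots_of_cartanNumber_eq_one
        (T.add_isotropic_mem_nonisotropicRoots hσ hγ hγσ) (hK.subset hβ).1 h1)
      rwa [neg_sub, add_sub_right_comm] at this
  exact (hK.transGen γ hγ α hα).trans_induction_on (motive := fun {a b} _ =>
    a + σ ∈ T.roots → b + σ ∈ T.roots) (fun h => h.add_isotropic_mem hσ)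
    (fun _ _ h h' => h' ∘ h) hγσ

end Shift

end ExtendedAffineLie

namespace ExtendedAffineLie

variable {E : Type*} [LieRing E] [LieAlgebra ℂ E] (T : ExtendedAffineLie E)

open Relation SplitInvariantLie

/-! ### The scalars of a Cartan automorphism -/

/-- `Ψ` acts on `E_α` as the scalar `η α`, for all `α ∈ R^×`. -/
def IsScalarFunction (Ψ : E ≃ₗ⁅ℂ⁆ E) (η : Dual ℂ T.H → ℂˣ) : Prop :=
  ∀ α ∈ T.nonisotropicRoots, ∀ x ∈ T.rootSpace α, Ψ x = (η α : ℂ) • x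

variable {T} {Ψ : E ≃ₗ⁅ℂ⁆ E} {η : Dual ℂ T.H → ℂˣ}

lemma IsCartanAutomorphism.apply_mem_rootSpace (hΨ : T.IsCartanAutomorphism Ψ) {α : Dual ℂ T.H}
    {x : E} (hx : x ∈ T.rootSpace α) : Ψ x ∈ T.rootSpace α := by
  rw [mem_rootSpace] at *
  intro h
  have h1 := Ψ.map_lie (h : E) x
  rw [hΨ h, hx, map_smul] at h1
  exact h1.symm

lemma IsCartanAutomorphism.exists_isScalarFunction (hΨ : T.IsCartanAutomorphism Ψ) :
    ∃ η, T.IsScalarFunction Ψ η := by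
  have key : ∀ α : Dual ℂ T.H, ∃ c : ℂˣ, α ∈ T.nonisotropicRoots →
      ∀ x ∈ T.rootSpace α, Ψ x = (c : ℂ) • x := by
    intro α
    by_cases hα : α ∈ T.nonisotropicRoots
    · obtain ⟨e, he, he0⟩ := T.exists_ne_zero_of_mem_roots hα.1
      obtain ⟨c, hc⟩ := T.exists_eq_smul hα he he0 (hΨ.apply_mem_rootSpace he)
      have hc0 : c ≠ 0 := by
        rintro rfl
        rw [zero_smul] at hc
        exact he0 (Ψ.injective (hc.trans (map_zero Ψ).symm))
      refine ⟨Units.mk0 c hc0, fun _ x hx => ?_⟩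
      obtain ⟨d, rfl⟩ := T.exists_eq_smul hα he he0 hx
      rw [map_smul, hc, Units.val_mk0, smul_comm]
    · exact ⟨1, fun h => absurd h hα⟩
  choose η hη using key
  exact ⟨η, hη⟩

lemma IsScalarFunction.add (h : T.IsScalarFunction Ψ η) {α β : Dual ℂ T.H}
    (hα : α ∈ T.nonisotropicRoots) (hβ : β ∈ T.nonisotropicRoots)
    (hαβ : α + β ∈ T.nonisotropicRoots) : η (α + β) = η α * η β := by
  obtain ⟨e, he, he0⟩ := T.exists_ne_zero_of_mem_roots hα.1
  obtain ⟨f, hf, hf0⟩ := T.exists_ne_zero_of_mem_roots hβ.1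
  have h0 := T.lie_ne_zero hα hβ hαβ.1 he he0 hf hf0
  have h1 := h _ hαβ _ (T.lie_mem_rootSpace he hf)
  rw [LieEquiv.map_lie, h α hα e he, h β hβ f hf, smul_lie, lie_smul, smul_smul] at h1
  exact Units.ext (by simpa using (smul_left_injective ℂ h0 h1).symm)

/-- `Ψ` fixes the coroot `[e, f]`. -/
lemma IsScalarFunction.mul_neg (h : T.IsScalarFunction Ψ η) (hΨ : T.IsCartanAutomorphism Ψ)
    {α : Dual ℂ T.H} (hα : α ∈ T.nonisotropicRoots) : η α * η (-α) = 1 := by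
  obtain ⟨e, he, he0⟩ := T.exists_ne_zero_of_mem_roots hα.1
  obtain ⟨f, hf, t⟩ := T.exists_isSl2Triple hα he he0
  have h1 := hΨ (T.corootH α)
  rw [← t.lie_e_f, LieEquiv.map_lie, h α hα e he, h _ (T.neg_mem_nonisotropicRoots hα) f hf,
    smul_lie, lie_smul, smul_smul, t.lie_e_f] at h1
  have h2 : ((η α : ℂ) * η (-α)) • (T.corootH α : E) = (1 : ℂ) • (T.corootH α : E) := by
    rw [h1, one_smul]
  exact Units.ext (by simpa using smul_left_injective ℂ t.h_ne_zero h2)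

lemma IsScalarFunction.neg (h : T.IsScalarFunction Ψ η) (hΨ : T.IsCartanAutomorphism Ψ)
    {α : Dual ℂ T.H} (hα : α ∈ T.nonisotropicRoots) : η (-α) = (η α)⁻¹ :=
  eq_inv_of_mul_eq_one_right (h.mul_neg hΨ hα)

/-- Adding the root `β - α` to `α` and to `α + σ` multiplies both scalars by `η (β - α)`. -/
lemma Linked.ratio_eq (h : T.IsScalarFunction Ψ η) {α β σ : Dual ℂ T.H} (hαβ : T.Linked α β)
    (hσ : σ ∈ T.isotropicRoots) (hασ : α + σ ∈ T.roots) (hβσ : β + σ ∈ T.roots) :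
    η (α + σ) / η α = η (β + σ) / η β := by
  have h1 := h.add hαβ.1 hαβ.sub_mem (by rw [add_sub_cancel]; exact hαβ.2.1)
  have h2 := h.add (T.add_isotropic_mem_nonisotropicRoots hσ hαβ.1 hασ) hαβ.sub_mem
    (by rw [show α + σ + (β - α) = β + σ by abel]
        exact T.add_isotropic_mem_nonisotropicRoots hσ hαβ.2.1 hβσ)
  rw [add_sub_cancel] at h1
  rw [show α + σ + (β - α) = β + σ by abel] at h2
  rw [h1, h2, mul_div_mul_right_eq_div]

lemma IsShortClass.ratio_eq {K : Set (Dual ℂ T.H)} (hK : T.IsShortClass K)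
    (h : T.IsScalarFunction Ψ η) {α₀ α σ : Dual ℂ T.H} (hα₀ : α₀ ∈ K)
    (hσ : σ ∈ T.isotropicRoots) (hα : α ∈ T.nonisotropicRoots) (hασ : α + σ ∈ T.roots) :
    η (α + σ) / η α = η (α₀ + σ) / η α₀ := by
  have key : ∀ β ∈ K, η (β + σ) / η β = η (α₀ + σ) / η α₀ := by
    intro β hβ
    have := (hK.transGen α₀ hα₀ β hβ).trans_induction_on (motive := fun {a b} _ =>
      a + σ ∈ T.roots → b + σ ∈ T.roots ∧ η (b + σ) / η b = η (a + σ) / η a)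
      (fun h' ha => ⟨h'.add_isotropic_mem hσ ha,
        (h'.ratio_eq h hσ ha (h'.add_isotropic_mem hσ ha)).symm⟩)
      (fun _ _ h h' ha => ⟨(h' (h ha).1).1, (h' (h ha).1).2.trans (h ha).2⟩)
    exact (this (hK.add_isotropic_mem hα₀ hσ)).2
  by_cases hαK : α ∈ K
  · exact key α hαK
  -- Outside `K`, write `α = (α - β) + β` and shift only the first summand; the factor `η β`
  -- cancels.
  obtain ⟨β, hβ, -, hsub⟩ := hK.exists_sub_mem α hα hαK
  rw [← key _ hsub]
  have hsubσ := hK.add_isotropic_mem hsub hσ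
  have h1 := h.add (hK.subset hsub) (hK.subset hβ) (by rwa [sub_add_cancel])
  have h2 := h.add (T.add_isotropic_mem_nonisotropicRoots hσ (hK.subset hsub) hsubσ) (hK.subset hβ)
    (by rw [show α - β + σ + β = α + σ by abel]
        exact T.add_isotropic_mem_nonisotropicRoots hσ hα hασ)
  rw [sub_add_cancel] at h1
  rw [show α - β + σ + β = α + σ by abel] at h2
  rw [h1, h2, mul_div_mul_right_eq_div]

/-! ### Multiplicative functions on the roots -/

variable (T) in
/-- The extension of `η` to all roots by `σ ↦ η (α₀ + σ) / η α₀` on isotropic roots. -/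
def extendScalar (η : Dual ℂ T.H → ℂˣ) (α₀ α : Dual ℂ T.H) : ℂˣ :=
  open Classical in if α ∈ T.nonisotropicRoots then η α else η (α₀ + α) / η α₀

lemma extendScalar_of_nonisotropic {α₀ α : Dual ℂ T.H} (hα : α ∈ T.nonisotropicRoots) :
    T.extendScalar η α₀ α = η α := if_pos hα

lemma extendScalar_of_isotropic {α₀ α : Dual ℂ T.H} (hα : α ∈ T.isotropicRoots) :
    T.extendScalar η α₀ α = η (α₀ + α) / η α₀ := if_neg fun h => h.2 hα.2

lemma add_mem_isotropicRoots {σ τ : Dual ℂ T.H} (hσ : σ ∈ T.isotropicRoots)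
    (hτ : τ ∈ T.isotropicRoots) (h : σ + τ ∈ T.roots) : σ + τ ∈ T.isotropicRoots :=
  ⟨h, by simp [hσ.2, hτ.2, T.dualForm_isotropic_eq_zero hσ hτ.1,
    T.dualForm_isotropic_eq_zero hτ hσ.1]⟩

lemma IsShortClass.extendScalar_add {K : Set (Dual ℂ T.H)} (hK : T.IsShortClass K)
    (h : T.IsScalarFunction Ψ η) (hΨ : T.IsCartanAutomorphism Ψ) {α₀ α β : Dual ℂ T.H}
    (hα₀ : α₀ ∈ K) (hα : α ∈ T.roots) (hβ : β ∈ T.roots) (hαβ : α + β ∈ T.roots) :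
    T.extendScalar η α₀ (α + β) = T.extendScalar η α₀ α * T.extendScalar η α₀ β := by
  have mixed : ∀ {α σ : Dual ℂ T.H}, α ∈ T.nonisotropicRoots → σ ∈ T.isotropicRoots →
      α + σ ∈ T.roots →
      T.extendScalar η α₀ (α + σ) = T.extendScalar η α₀ α * T.extendScalar η α₀ σ := by
    intro α σ hα hσ hασ
    rw [extendScalar_of_nonisotropic hα, extendScalar_of_isotropic hσ,
      extendScalar_of_nonisotropic (T.add_isotropic_mem_nonisotropicRoots hσ hα hασ),
      ← hK.ratio_eq h hα₀ hσ hα hασ, mul_div_cancel]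
  rcases T.isotropic_or_nonisotropic hα with hα | hα <;>
  rcases T.isotropic_or_nonisotropic hβ with hβ | hβ
  -- Two isotropic roots: evaluate the ratio for `β` at `α₀ + α` instead of `α₀`, so that the
  -- product telescopes.
  · have h1 := hK.add_isotropic_mem hα₀ hα
    have h1' := T.add_isotropic_mem_nonisotropicRoots hα (hK.subset hα₀) h1
    have h2 := hK.add_isotropic_mem hα₀ (add_mem_isotropicRoots hα hβ hαβ)
    rw [← add_assoc] at h2
    rw [extendScalar_of_isotropic (add_mem_isotropicRoots hα hβ hαβ), extendScalar_of_isotropic hα,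
      extendScalar_of_isotropic hβ, ← hK.ratio_eq h hα₀ hβ h1' h2, ← add_assoc,
      mul_comm, div_mul_div_cancel]
  · rw [add_comm, mixed hβ hα (by rwa [add_comm]), mul_comm]
  · exact mixed hα hβ hαβ
  · rcases T.isotropic_or_nonisotropic hαβ with hαβ | hαβ
    -- An isotropic sum: apply the mixed case to `β = -α + (α + β)`.
    · have h1 := mixed (T.neg_mem_nonisotropicRoots hα) hαβ (by simpa using hβ.1)
      rw [neg_add_cancel_left, extendScalar_of_nonisotropic (T.neg_mem_nonisotropicRoots hα),
        h.neg hΨ hα] at h1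
      rw [h1, extendScalar_of_nonisotropic hα, mul_inv_cancel_left]
    · rw [extendScalar_of_nonisotropic hα, extendScalar_of_nonisotropic hβ,
        extendScalar_of_nonisotropic hαβ, h.add hα hβ hαβ]

/-! ### Diagonal endomorphisms -/

variable (T) in
lemma isInternal_rootSpace : open Classical in DirectSum.IsInternal T.rootSpace := by
  classical
  have : IsLieAbelian T.H := ⟨fun a b => Subtype.ext (T.lie_eq_zero a b)⟩
  refine DirectSum.isInternal_submodule_of_iSupIndep_of_iSup_eq_top ?_ T.iSup_rootSpace
  have h1 := LieSubmodule.iSupIndep_toSubmodule.2 (LieModule.iSupIndep_genWeightSpace ℂ T.H E)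
  exact (h1.comp (f := fun α : Dual ℂ T.H => (α : T.H → ℂ)) DFunLike.coe_injective).mono
    fun α => LieModule.weightSpace_le_genWeightSpace E _

variable (T) in
/-- A function on the roots that is multiplicative gives a diagonal Lie algebra endomorphism. -/
lemma exists_diagonal_lieHom (χ : Dual ℂ T.H → ℂˣ)
    (hχ : ∀ α ∈ T.roots, ∀ β ∈ T.roots, α + β ∈ T.roots → χ (α + β) = χ α * χ β) :
    ∃ D : E →ₗ⁅ℂ⁆ E, ∀ α, ∀ x ∈ T.rootSpace α, D x = (χ α : ℂ) • x := by
  classical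
  let e := LinearEquiv.ofBijective (DirectSum.coeLinearMap T.rootSpace) T.isInternal_rootSpace
  let D : E →ₗ[ℂ] E :=
    DirectSum.toModule ℂ _ E (fun α => (χ α : ℂ) • (T.rootSpace α).subtype) ∘ₗ e.symm.toLinearMap
  have hD : ∀ α, ∀ x ∈ T.rootSpace α, D x = (χ α : ℂ) • x := by
    intro α x hx
    have : e.symm x = DirectSum.lof ℂ _ (fun α => T.rootSpace α) α ⟨x, hx⟩ := by
      rw [LinearEquiv.symm_apply_eq]
      exact (DirectSum.coeLinearMap_lof T.rootSpace α ⟨x, hx⟩).symm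
    simp [D, this]
  have hlie : ∀ x y, D ⁅x, y⁆ = ⁅D x, D y⁆ := by
    intro x y
    have hx : x ∈ ⨆ α, T.rootSpace α := by rw [T.iSup_rootSpace]; trivial
    have hy : y ∈ ⨆ α, T.rootSpace α := by rw [T.iSup_rootSpace]; trivial
    induction hx using Submodule.iSup_induction' with
    | zero => simp
    | add a b _ _ ha hb => rw [add_lie, map_add, ha, hb, map_add, add_lie]
    | mem α x hx =>
      induction hy using Submodule.iSup_induction' with
      | zero => simp
      | add a b _ _ ha hb => rw [lie_add, map_add, ha, hb, map_add, lie_add]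
      | mem β y hy =>
        rw [hD α x hx, hD β y hy, hD _ _ (T.lie_mem_rootSpace hx hy), smul_lie, lie_smul, smul_smul]
        by_cases h0 : ⁅x, y⁆ = 0
        · simp [h0]
        · have hα := T.mem_roots_of_ne_zero hx (by rintro rfl; simp at h0)
          have hβ := T.mem_roots_of_ne_zero hy (by rintro rfl; simp at h0)
          rw [hχ α hα β hβ (T.mem_roots_of_ne_zero (T.lie_mem_rootSpace hx hy) h0), Units.val_mul]
  exact ⟨{ D with map_lie' := fun {x y} => hlie x y }, hD⟩

lemma eq_on_core {Ψ : E ≃ₗ⁅ℂ⁆ E} {D : E →ₗ⁅ℂ⁆ E}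
    (h : ∀ α ∈ T.nonisotropicRoots, ∀ x ∈ T.rootSpace α, D x = Ψ x) {x : E} (hx : x ∈ T.core) :
    D x = Ψ x := by
  let C : LieSubalgebra ℂ E :=
    { LinearMap.eqLocus (D : E →ₗ[ℂ] E) ((Ψ : E →ₗ⁅ℂ⁆ E) : E →ₗ[ℂ] E) with
      lie_mem' := by
        intro a b ha hb
        change D a = Ψ a at ha
        change D b = Ψ b at hb
        change D ⁅a, b⁆ = Ψ ⁅a, b⁆
        rw [LieHom.map_lie, LieEquiv.map_lie, ha, hb] }
  have hle : T.core ≤ C := by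
    refine LieSubalgebra.lieSpan_le.2 fun y hy => ?_
    simp only [Set.mem_iUnion] at hy
    obtain ⟨α, hα, hy⟩ := hy
    exact h α hα y hy
  exact hle hx

/-- A finite order automorphism extending a diagonal one from the core is diagonal. -/
lemma apply_eq_smul (h : T.IsScalarFunction Ψ η) (hΨ : T.IsCartanAutomorphism Ψ)
    (hfin : ∃ m : ℕ, 0 < m ∧ ∀ x : E, Ψ^[m] x = x) {χ : Dual ℂ T.H → ℂˣ}
    (hχη : ∀ α ∈ T.nonisotropicRoots, χ α = η α)
    (hχ : ∀ α ∈ T.roots, ∀ β ∈ T.roots, α + β ∈ T.roots → χ (α + β) = χ α * χ β)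
    {σ : Dual ℂ T.H} (hσ : σ ∈ T.isotropicRoots) {x : E} (hx : x ∈ T.rootSpace σ) :
    Ψ x = (χ σ : ℂ) • x := by
  obtain ⟨m, hm, hfin⟩ := hfin
  obtain ⟨D, hD⟩ := T.exists_diagonal_lieHom χ hχ
  have hDΨ : ∀ α ∈ T.nonisotropicRoots, ∀ x ∈ T.rootSpace α, D x = Ψ x := by
    intro α hα x hx
    rw [hD α x hx, h α hα x hx, hχη α hα]
  set z := Ψ x - (χ σ : ℂ) • x with hz
  have hzσ : z ∈ T.rootSpace σ :=
    Submodule.sub_mem _ (hΨ.apply_mem_rootSpace hx) (Submodule.smul_mem _ _ hx)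
  have hzc : z ∈ T.core := by
    refine T.tame z fun y hy => T.lie_eq_zero_of_mem_core (fun α hα y hy => ?_) hy
    -- `[x, y]` is zero or in a non-isotropic root space, where `Ψ` and `D` agree; hence `[Ψ x - D
    -- x, Ψ y] = 0`.
    have h1 : Ψ ⁅x, y⁆ = D ⁅x, y⁆ := by
      by_cases h0 : ⁅x, y⁆ = 0
      · rw [h0, map_zero, map_zero]
      · have hmem := T.lie_mem_rootSpace hx hy
        rw [add_comm] at hmem
        exact (hDΨ _ (T.add_isotropic_mem_nonisotropicRoots hσ hα
          (T.mem_roots_of_ne_zero hmem h0)) _ hmem).symm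
    rw [LieEquiv.map_lie, LieHom.map_lie, hDΨ α hα y hy, hD σ x hx, ← sub_eq_zero, ← sub_lie,
      h α hα y hy, lie_smul, smul_eq_zero] at h1
    exact h1.resolve_left (η α).ne_zero
  have hΨz : Ψ z = (χ σ : ℂ) • z := by rw [← eq_on_core hDΨ hzc, hD σ z hzσ]
  have hΨx : Ψ x = (χ σ : ℂ) • x + z := by rw [hz]; abel
  have hpow : ∀ n : ℕ, Ψ^[n] z = (χ σ : ℂ) ^ n • z := by
    intro n
    induction n with
    | zero => simp
    | succ n ih => rw [Function.iterate_succ_apply', ih, map_smul, hΨz, smul_smul, pow_succ]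
  -- Powers of a Jordan block; the extra factor `χ σ` avoids the exponent `n - 1`. At `n = m`, with
  -- `χ σ ^ m = 1`, this leaves `m z = 0`.
  have hpow' : ∀ n : ℕ, (χ σ : ℂ) • Ψ^[n] x = (χ σ : ℂ) ^ (n + 1) • x + ((n : ℂ) * χ σ ^ n) • z := by
    intro n
    induction n with
    | zero => simp
    | succ n ih =>
      rw [Function.iterate_succ_apply', ← map_smul, ih, map_add, map_smul, map_smul, hΨx, hΨz]
      push_cast
      module
  by_contra hne
  have hz0 : z ≠ 0 := sub_ne_zero.2 hne
  have h1 : (χ σ : ℂ) ^ m = 1 := by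
    have := (hpow m).symm.trans (hfin z)
    exact smul_left_injective ℂ hz0 (by simpa using this)
  have h2 := hpow' m
  rw [hfin, pow_succ, h1, one_mul, mul_one, left_eq_add, smul_eq_zero] at h2
  exact h2.elim (fun h => hm.ne' (by exact_mod_cast h)) hz0

lemma IsAssociatedMap.unique {φ ψ : T.roots → ℂˣ} (hφ : T.IsAssociatedMap Ψ φ)
    (hψ : T.IsAssociatedMap Ψ ψ) : φ = ψ := by
  have hnon : ∀ α : T.roots, (α : Dual ℂ T.H) ∈ T.nonisotropicRoots → φ α = ψ α := by
    intro α hα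
    obtain ⟨x, hx, hx0⟩ := T.exists_ne_zero_of_mem_roots hα.1
    exact Units.ext (smul_left_injective ℂ hx0 ((hφ.1 α hα x hx).symm.trans (hψ.1 α hα x hx)))
  funext σ
  rcases T.isotropic_or_nonisotropic σ.2 with hσ | hσ
  · obtain ⟨α, hα, hασ⟩ := T.exists_add_mem_roots hσ
    have hβ := T.add_isotropic_mem_nonisotropicRoots hσ hα hασ
    have hγ := T.neg_mem_nonisotropicRoots hα
    have hγ' := T.neg_mem_roots hα.1
    rw [hφ.2 σ ⟨α, hα.1⟩ ⟨_, hασ⟩ ⟨-α, hγ'⟩ hσ hα hβ rfl rfl,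
      hψ.2 σ ⟨α, hα.1⟩ ⟨_, hασ⟩ ⟨-α, hγ'⟩ hσ hα hβ rfl rfl, hnon ⟨_, hασ⟩ hβ, hnon ⟨-α, hγ'⟩ hγ]
  · exact hnon σ hσ

end ExtendedAffineLie

end

/-! ### The main result. -/

theorem proposition4p13 {E : Type*} [LieRing E] [LieAlgebra ℂ E] (T : ExtendedAffineLie E)
    (hX : (∃ ℓ : ℕ, 3 ≤ ℓ ∧ T.HasCartanType (CartanMatrix.C ℓ)) ∨
      T.HasCartanType CartanMatrix.F₄ ∨ T.HasCartanType CartanMatrix.G₂)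
    (Ψ : E ≃ₗ⁅ℂ⁆ E) (hΨ : T.IsCartanAutomorphism Ψ)
    (hfin : ∃ m : ℕ, 0 < m ∧ ∀ x : E, Ψ^[m] x = x) :
    T.IsDiagonal Ψ ∧
      (∃! ψ : T.roots → ℂˣ, T.IsAssociatedMap Ψ ψ) ∧
      ∀ ψ : T.roots → ℂˣ, T.IsAssociatedMap Ψ ψ → T.IsCharacter ψ := by
  obtain ⟨K, hK⟩ := T.exists_isShortClass hX
  obtain ⟨α₀, hα₀⟩ := hK.nonempty
  obtain ⟨η, hη⟩ := hΨ.exists_isScalarFunction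
  obtain ⟨χ, hχη, hχ⟩ : ∃ χ : Dual ℂ T.H → ℂˣ, (∀ α ∈ T.nonisotropicRoots, χ α = η α) ∧
      ∀ α ∈ T.roots, ∀ β ∈ T.roots, α + β ∈ T.roots → χ (α + β) = χ α * χ β :=
    ⟨T.extendScalar η α₀, fun α hα => ExtendedAffineLie.extendScalar_of_nonisotropic hα,
      fun α hα β hβ => hK.extendScalar_add hη hΨ hα₀ hα hβ⟩
  have hassoc : T.IsAssociatedMap Ψ fun α : T.roots => χ α := by
    refine ⟨fun α hα x hx => ?_, ?_⟩
    · change Ψ x = (χ α : ℂ) • x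
      rw [hχη α hα]
      exact hη α hα x hx
    intro σ α β γ hσ hα hβ hβα hγ
    -- As `σ = (α + σ) + (-α)`, the defining relation at `σ` is an instance of multiplicativity of
    -- `χ`, for every admissible `α`.
    have hσ' : (σ : Dual ℂ T.H) = β + γ := by rw [hβα, hγ]; abel
    change χ σ = χ β * χ γ
    rw [hσ']
    exact hχ β β.2 γ γ.2 (by rw [← hσ']; exact σ.2)
  have huniq : ∀ ψ : T.roots → ℂˣ, T.IsAssociatedMap Ψ ψ → ψ = fun α : T.roots => χ α :=
    fun ψ hψ => hψ.unique hassoc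
  refine ⟨fun α hα => ⟨χ α, fun x hx => ?_⟩, ⟨_, hassoc, huniq⟩, fun ψ hψ => ?_⟩
  · rcases T.isotropic_or_nonisotropic hα with h | h
    · exact ExtendedAffineLie.apply_eq_smul hη hΨ hfin hχη hχ h hx
    · rw [hχη α h]; exact hη α h x hx
  · rw [huniq ψ hψ]
    intro α β γ hγ
    change χ γ = χ α * χ β
    rw [hγ]
    exact hχ α α.2 β β.2 (by rw [← hγ]; exact γ.2)
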